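/- Let $\Omega\subset\mathbb C$ be a bounded simply connected domain with Lipschitz boundary, and let $$\Phi(\zeta)=c\,\zeta+\mu_0+\frac{\mu_1}{\zeta}+\frac{\mu_2}{\zeta^2}+\cdots,\qquad c=\mu_{-1}>0,$$ be the conformal mapping of $\{|\zeta|>1\}$ onto $\mathbb C\setminus\overline\Omega$. For $n\ge 1$ put $P_n^c=r^n\cos n\theta$, $P_n^s=r^n\sin n\theta$, and for $\beta\in\{c,s\}$ let $u$ be the finite-energy (weak) solution of $$\Delta u=0\ \text{ in }\mathbb C\setminus\overline\Omega,\qquad \partial u/\partial\nu=0\ \text{ on }\partial\Omega,\qquad u-P_n^\beta=O(|z|^{-1})\ \text{ as }|z|\to\infty .$$ The generalized polarization tensors $M_{mn}^{\alpha\beta}$ (real numbers, $m,n\ge1$) of the insulated inclusion $\Omega$ are defined by $$u-P_n^\beta=-\sum_{m\ge1}\frac{M_{mn}^{c\beta}\cos m\theta+M_{mn}^{s\beta}\sin m\theta}{2\pi m\,r^m}\qquad\text{for large } r=|z| ,$$ and $$\gamma^1_{mn}=\tfrac1{4\pi m}\bigl(M^{cc}_{mn}-M^{ss}_{mn}+i(M^{cs}_{mn}+M^{sc}_{mn})\bigr),\qquad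 \gamma^2_{mn}=\tfrac1{4\pi m}\bigl(M^{cc}_{mn}+M^{ss}_{mn}-i(M^{cs}_{mn}-M^{sc}_{mn})\bigr).$$ Put $B_1=1/c$ and, for $k\ge2$, $$B_k=\frac1c\sum\Bigl(\frac{-1}{c}\Bigr)^{s_1+\cdots+s_j}\frac{(s_1+\cdots+s_j)!}{s_1!\cdots s_j!}\,\mu_{k_1-1}^{s_1}\cdots\mu_{k_j-1}^{s_j},$$ the sum being over all $j\ge1$, $0<k_1<\cdots<k_j$ and $s_1,\dots,s_j>0$ with $s_1k_1+\cdots+s_jk_j=k-1$. Then: 1. The tensors $M^{\alpha\beta}_{m1}$, $m\ge1$, are well defined: for $n=1$ and each $\beta$ a solution $u$ with such an expansion exists, and the coefficients are unique. 2. $1/\Phi(\zeta)=\sum_{k\ge1}B_k\zeta^{-k}$ for all large $|\zeta|$, and $B_k$ depends only on $c$ and on those $\mu_j$, $j\ge 0$, with $j\le k-2$. 3. $c^2=-\gamma^2_{11}$ and $\mu_0=-c^{-2}\gamma^2_{21}$. 4. For every $\ell\ge1$, $$\mu_\ell=\sum\gamma^1_{s_1+\cdots+s_j,\,1}\,\frac{(s_1+\cdots+s_j)!}{s_1!\cdots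 s_j!}\,B_{n_1}^{s_1}\cdots B_{n_j}^{s_j},$$ the sum being over all $j\ge1$, $0<n_1<\cdots<n_j$ and $s_1,\dots,s_j>0$ with $s_1n_1+\cdots+s_jn_j=\ell$. 5. Consequently the conformal map is determined by $\gamma^2_{11}$, $\gamma^2_{21}$ and $\{\gamma^1_{m1}\}_{m\in\mathbb N}$, inductively: if $\Omega'$ is another bounded simply connected Lipschitz domain, with conformal map $\Phi'$ and coefficients $c',\mu'_\ell$, whose $\gamma^2_{11}$ and $\gamma^2_{21}$ are the same as those of $\Omega$, then for every $N\ge0$ equality of the $\gamma^1_{m1}$ for all $1\le m\le N$ implies $c'=c$ and $\mu'_\ell=\mu_\ell$ for $0\le\ell\le N$; and equality of the $\gamma^1_{m1}$ for all $m\ge1$ implies $\Phi'=\Phi$ on $|\zeta|>1$. -/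

import Mathlib

open Set Filter Topology MeasureTheory Asymptotics Bornology
open scoped Gradient Nat ContDiff

/-- A bounded planar domain with Lipschitz boundary: near each boundary point the set is, up to a
rotation of the coordinates, the region above the graph of a Lipschitz function. -/
structure IsBoundedLipschitzDomain (Ω : Set ℂ) : Prop where
  isOpen : IsOpen Ω
  isConnected : IsConnected Ω
  isBounded : IsBounded Ω
  lipschitz_boundary : ∀ p ∈ frontier Ω, ∃ (a : ℂ) (K : NNReal) (f : ℝ → ℝ),
    ‖a‖ = 1 ∧ LipschitzWith K f ∧ ∀ᶠ z in 𝓝 p, (z ∈ Ω ↔ f (a * z).re < (a * z).im)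

/-- The exterior `ℂ \ closure Ω`. -/
def exteriorOf (Ω : Set ℂ) : Set ℂ := (closure Ω)ᶜ

/-- Test functions for the exterior Neumann problem: smooth functions on the exterior domain that
lie in the Sobolev space `H¹` and vanish outside a bounded set. They need not vanish on the
boundary. -/
structure IsExteriorTestFunction (Ω : Set ℂ) (v : ℂ → ℝ) : Prop where
  smooth : ContDiffOn ℝ ∞ v (exteriorOf Ω)
  bounded_support : ∃ R : ℝ, ∀ z ∈ exteriorOf Ω, R ≤ ‖z‖ → v z = 0
  sq_integrable : IntegrableOn (fun z => v z ^ 2) (exteriorOf Ω)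
  grad_sq_integrable : IntegrableOn (fun z => ‖∇ v z‖ ^ 2) (exteriorOf Ω)

/-- `u` is a (finite energy) solution of the insulated transmission problem with background
potential `h`: `Δ u = 0` in `ℂ \ closure Ω`, `∂u/∂ν = 0` on `∂Ω` in the weak (variational) sense,
and `u - h = O(|z|⁻¹)` at infinity. -/
structure IsNeumannSolution (Ω : Set ℂ) (h u : ℂ → ℝ) : Prop where
  harmonic : InnerProductSpace.HarmonicOnNhd u (exteriorOf Ω)
  sq_integrable : ∀ R : ℝ, IntegrableOn (fun z => u z ^ 2) (exteriorOf Ω ∩ Metric.ball 0 R)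
  grad_sq_integrable : ∀ R : ℝ,
    IntegrableOn (fun z => ‖∇ u z‖ ^ 2) (exteriorOf Ω ∩ Metric.ball 0 R)
  neumann : ∀ v : ℂ → ℝ, IsExteriorTestFunction Ω v →
    ∫ z in exteriorOf Ω, inner ℝ (∇ u z) (∇ v z) = 0
  decay : (fun z => u z - h z) =O[cobounded ℂ] fun z => ‖z‖⁻¹

/-- The superscripts `c` (cosine) and `s` (sine) of the contracted tensors. -/
inductive Trig
  | c
  | s

/-- `P_n^c = r^n cos nθ` and `P_n^s = r^n sin nθ`. -/
noncomputable def harmonicPoly : Trig → ℕ → ℂ → ℝ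
  | .c, n, z => ‖z‖ ^ n * Real.cos (n * z.arg)
  | .s, n, z => ‖z‖ ^ n * Real.sin (n * z.arg)

/-- `A α m` (`m ≥ 1`) are the coefficients `M_{mn}^{αβ}` in the multipolar expansion at infinity
of `u - h`, where `u` solves the insulated problem with background potential `h = P_n^β`:
`(u - h)(z) = - ∑_{m ≥ 1} (A c m cos mθ + A s m sin mθ) / (2 π m r^m)` for all large `r = |z|`. -/
def IsMultipolarExpansion (Ω : Set ℂ) (β : Trig) (n : ℕ) (A : Trig → ℕ → ℝ) : Prop :=
  ∃ u : ℂ → ℝ, IsNeumannSolution Ω (harmonicPoly β n) u ∧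
    ∀ᶠ z in cobounded ℂ, HasSum
      (fun i : ℕ => -((A .c (i + 1) * Real.cos ((i + 1 : ℕ) * z.arg)
        + A .s (i + 1) * Real.sin ((i + 1 : ℕ) * z.arg))
          / (2 * Real.pi * (i + 1 : ℕ) * ‖z‖ ^ (i + 1))))
      (u z - harmonicPoly β n z)

/-- The contracted generalized polarization tensors `M_{mn}^{αβ}` (`m, n ≥ 1`) of the insulated
inclusion `Ω`. -/
noncomputable def gpt (Ω : Set ℂ) (α β : Trig) (m n : ℕ) : ℝ :=
  Classical.epsilon (IsMultipolarExpansion Ω β n) α m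

noncomputable def gamma1 (Ω : Set ℂ) (m n : ℕ) : ℂ :=
  1 / (4 * Real.pi * m) * ((gpt Ω .c .c m n : ℂ) - gpt Ω .s .s m n
    + Complex.I * (gpt Ω .c .s m n + gpt Ω .s .c m n))

noncomputable def gamma2 (Ω : Set ℂ) (m n : ℕ) : ℂ :=
  1 / (4 * Real.pi * m) * ((gpt Ω .c .c m n : ℂ) + gpt Ω .s .s m n
    - Complex.I * (gpt Ω .c .s m n - gpt Ω .s .c m n))

/-- `Φ` maps `|ζ| > 1` conformally onto `ℂ \ closure Ω`, with
`Φ ζ = c ζ + μ 0 + μ 1 / ζ + μ 2 / ζ² + ⋯` and `c > 0`. -/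
structure IsExteriorConformalMap (Ω : Set ℂ) (Φ : ℂ → ℂ) (c : ℝ) (μ : ℕ → ℂ) : Prop where
  holomorphic : DifferentiableOn ℂ Φ {ζ | 1 < ‖ζ‖}
  bijective : BijOn Φ {ζ | 1 < ‖ζ‖} (exteriorOf Ω)
  pos : 0 < c
  expansion : ∀ ζ : ℂ, 1 < ‖ζ‖ → HasSum (fun l : ℕ => μ l / ζ ^ l) (Φ ζ - c * ζ)

/-- `(s₁ + ⋯ + s_j)! / (s₁! ⋯ s_j!)`, where `s₁, …, s_j` are the multiplicities of the distinct
parts of a partition. A partition of `ℓ` is the same as a choice of distinct parts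
`0 < n₁ < ⋯ < n_j` and multiplicities `s_i > 0` with `s₁ n₁ + ⋯ + s_j n_j = ℓ`, and the number
`Multiset.card` of its parts is `s₁ + ⋯ + s_j`. -/
noncomputable def multinomialCoeff {l : ℕ} (p : Nat.Partition l) : ℂ :=
  ((Multiset.card p.parts)! : ℂ) / ∏ n ∈ p.parts.toFinset, ((p.parts.count n)! : ℂ)

/-- The numbers `B_k`, `k ≥ 1` (with `B_0 = 0`), as explicit polynomials in the coefficients `μ`
and in `1 / c`:
`B_k = (1/c) ∑ (-1/c)^(s₁+⋯+s_j) (s₁+⋯+s_j)!/(s₁!⋯s_j!) μ_{k₁-1}^{s₁} ⋯ μ_{k_j-1}^{s_j}`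
over `s₁ k₁ + ⋯ + s_j k_j = k - 1`. The empty partition gives `B_1 = 1 / c`. -/
noncomputable def coeffB (c : ℝ) (μ : ℕ → ℂ) : ℕ → ℂ
  | 0 => 0
  | k + 1 => 1 / (c : ℂ) * ∑ p : Nat.Partition k,
      (-1 / (c : ℂ)) ^ (Multiset.card p.parts) * multinomialCoeff p
        * ∏ n ∈ p.parts.toFinset, μ (n - 1) ^ p.parts.count n

/-!
Let `Ψ` be the inverse of the exterior conformal map `Φ`. By conformal invariance of the Neumann
problem, the solution with background potential `Re (a z)` pulls back to the exterior of the unit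
disk as `Re (a (c ζ + μ₀) + conj a c / ζ)`, so it is the real part of
`a (c Ψ + μ₀) + conj a c / Ψ` (`IsExteriorConformalMap.potential`). With `ζ = Ψ z`, subtracting
`a z` leaves `conj a c / ζ - a ∑_{l ≥ 1} μ_l ζ ^ (-l)`, which is holomorphic at infinity. Taking
`a = 1` and `a = -i`, the combinations that define the tensors `γ¹` and `γ²` separate the two parts:
`∑ γ¹_{m1} z ^ (-m) = ∑_{l ≥ 1} μ_l ζ ^ (-l)` and `∑ γ²_{m1} z ^ (-m) = -c / ζ`
(`IsExteriorConformalMap.exists_hasTaylorAtZero_gamma`). Substituting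
`1 / z = 1 / Φ ζ = ∑ B_k ζ ^ (-k)` and comparing coefficients gives all the formulas; the sums over
partitions come from the composition of power series (`HasTaylorAtZero.comp`), where the
multinomial coefficient counts the orderings of a partition.

The analytic part is that this function is a weak solution and that it is the only one.

* For the weak Neumann condition, the Dirichlet pairing is transported by `w ↦ Φ (e ^ w)` to the
  half-strip `Re w > 0`, `-π < Im w ≤ π`, where Green's formula on `Re w > ε` leaves a boundary term
  with the factor `1 - e ^ (-2 ε)`. Its other factor stays bounded because it is itself the boundary
  term of another field, paired with a test function of finite energy
  (`setIntegral_halfStrip_re_eq_zero`).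
* Uniqueness follows by testing the difference of two solutions against itself times a cutoff
  function, by Caccioppoli's inequality (`IsNeumannSolution.eqOn`).
* The coefficients of a multipolar expansion are unique although only pointwise convergence is
  assumed (`eq_zero_of_hasSum_re`).

The inverse map is holomorphic because an injective holomorphic function has no critical points
(`Set.InjOn.deriv_ne_zero`), and near infinity it is `z ↦ 1 / κ (1 / z)` for the local inverse `κ`
of `w ↦ 1 / Φ (1 / w)` (`IsExteriorConformalMap.exists_inverse_germ`).
-/

/-! ### Power series at the origin -/

/-- `f` is the sum of the convergent power series `∑ aₙ wⁿ` for all `w` close to `0`. -/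
def HasTaylorAtZero (f : ℂ → ℂ) (a : ℕ → ℂ) : Prop :=
  ∀ᶠ w in 𝓝 (0 : ℂ), HasSum (fun n : ℕ => a n * w ^ n) (f w)

theorem hasTaylorAtZero_iff {f : ℂ → ℂ} {a : ℕ → ℂ} :
    HasTaylorAtZero f a ↔ HasFPowerSeriesAt f (FormalMultilinearSeries.ofScalars ℂ a) 0 := by
  rw [hasFPowerSeriesAt_iff]
  simp [HasTaylorAtZero, FormalMultilinearSeries.coeff_ofScalars, mul_comm]

theorem HasTaylorAtZero.analyticAt {f : ℂ → ℂ} {a : ℕ → ℂ} (h : HasTaylorAtZero f a) :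
    AnalyticAt ℂ f 0 :=
  (hasTaylorAtZero_iff.1 h).analyticAt

theorem AnalyticAt.exists_hasTaylorAtZero {f : ℂ → ℂ} (h : AnalyticAt ℂ f 0) :
    ∃ a, HasTaylorAtZero f a := by
  obtain ⟨p, hp⟩ := h
  refine ⟨p.coeff, ?_⟩
  rw [hasFPowerSeriesAt_iff] at hp
  simpa [HasTaylorAtZero, mul_comm] using hp

theorem HasTaylorAtZero.unique {f : ℂ → ℂ} {a b : ℕ → ℂ} (ha : HasTaylorAtZero f a)
    (hb : HasTaylorAtZero f b) : a = b :=
  FormalMultilinearSeries.ofScalars_series_injective ℂ ℂ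
    ((hasTaylorAtZero_iff.1 ha).eq_formalMultilinearSeries (hasTaylorAtZero_iff.1 hb))

theorem HasTaylorAtZero.congr {f g : ℂ → ℂ} {a : ℕ → ℂ} (ha : HasTaylorAtZero f a)
    (h : f =ᶠ[𝓝 0] g) : HasTaylorAtZero g a := by
  filter_upwards [ha, h] with w hw hfg
  rwa [← hfg]

theorem HasTaylorAtZero.apply_zero {f : ℂ → ℂ} {a : ℕ → ℂ} (ha : HasTaylorAtZero f a) :
    f 0 = a 0 := by
  have h : HasSum (fun n : ℕ => a n * 0 ^ n) (f 0) :=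
    Filter.Eventually.self_of_nhds (p := fun w => HasSum (fun n : ℕ => a n * w ^ n) (f w)) ha
  refine h.unique ?_
  simpa using hasSum_single (f := fun n : ℕ => a n * 0 ^ n) 0 (fun n hn => by simp [hn])

/-! ### Compositions and partitions -/

/-- The number of orderings of a multiset is a multinomial coefficient. -/
theorem Multiset.card_lists_mul_prod_factorial {α : Type*} [DecidableEq α] (T : Finset α) :
    ∀ (n : ℕ) (s : Multiset α), Multiset.card s = n → s.toFinset ⊆ T →
      ∃ L : Finset (List α), (∀ l : List α, l ∈ L ↔ (l : Multiset α) = s) ∧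
        L.card * ∏ a ∈ T, (s.count a)! = n ! := by
  intro n
  induction n with
  | zero =>
    intro s hs _
    rw [Multiset.card_eq_zero] at hs
    subst hs
    refine ⟨{[]}, fun l => by simp, by simp⟩
  | succ n ih =>
    intro s hs hT
    have key : ∀ a : α, ∃ L : Finset (List α), a ∈ s →
        (∀ l : List α, l ∈ L ↔ (l : Multiset α) = s.erase a) ∧
        L.card * ∏ b ∈ T, ((s.erase a).count b)! = n ! := by
      intro a
      by_cases ha : a ∈ s
      · obtain ⟨L, hL⟩ := ih (s.erase a) (by rw [Multiset.card_erase_of_mem ha, hs]; rfl)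
          (fun b hb => hT (by
            rw [Multiset.mem_toFinset] at hb ⊢
            exact Multiset.mem_of_mem_erase hb))
        exact ⟨L, fun _ => hL⟩
      · exact ⟨∅, fun h => absurd h ha⟩
    choose L hL using key
    refine ⟨s.toFinset.biUnion fun a => (L a).image (List.cons a), ?_, ?_⟩
    · intro l
      simp only [Finset.mem_biUnion, Multiset.mem_toFinset, Finset.mem_image]
      constructor
      · rintro ⟨a, ha, l', hl', rfl⟩
        rw [← Multiset.cons_coe, ((hL a ha).1 l').1 hl', Multiset.cons_erase ha]
      · intro h
        cases l with
        | nil => simp [← h] at hs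
        | cons a l =>
          have ha : a ∈ s := by simp [← h]
          exact ⟨a, ha, l, ((hL a ha).1 l).2 (by simp [← h]), rfl⟩
    · rw [Finset.card_biUnion, Finset.sum_mul]
      · have : ∀ a ∈ s.toFinset, ((L a).image (List.cons a)).card * ∏ b ∈ T, (s.count b)!
            = n ! * s.count a := by
          intro a ha
          have ha' := Multiset.mem_toFinset.1 ha
          rw [Finset.card_image_of_injective _ (List.cons_injective), ← (hL a ha').2, mul_assoc]
          congr 1
          rw [← Finset.mul_prod_erase T _ (hT ha), ← Finset.mul_prod_erase T _ (hT ha),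
            Multiset.count_erase_self]
          have h1 : (s.count a)! = s.count a * (s.count a - 1)! :=
            (Nat.mul_factorial_pred (Multiset.count_ne_zero.2 ha')).symm
          have h2 : ∏ b ∈ T.erase a, ((s.erase a).count b)! = ∏ b ∈ T.erase a, (s.count b)! :=
            Finset.prod_congr rfl fun b hb => by
              rw [Multiset.count_erase_of_ne (Finset.ne_of_mem_erase hb)]
          rw [h1, h2]
          ring
        rw [Finset.sum_congr rfl this, ← Finset.mul_sum, Multiset.toFinset_sum_count_eq, hs,
          Nat.factorial_succ, mul_comm]
      · intro a _ b _ hab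
        simp only [Function.onFun, Finset.disjoint_left, Finset.mem_image, not_exists, not_and]
        rintro _ ⟨l, _, rfl⟩ l' _ h
        exact hab (List.cons.inj h).1.symm

theorem card_filter_ofComposition {l : ℕ} (p : Nat.Partition l) :
    ((Finset.univ.filter fun c : Composition l => Nat.Partition.ofComposition l c = p).card : ℂ)
      = multinomialCoeff p := by
  obtain ⟨L, hL, hcard⟩ := Multiset.card_lists_mul_prod_factorial p.parts.toFinset _ p.parts rfl
    subset_rfl
  have h1 : (Finset.univ.filter fun c : Composition l =>
      Nat.Partition.ofComposition l c = p).card = L.card := by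
    refine Finset.card_bij (fun c _ => c.blocks) ?_ ?_ ?_
    · intro c hc
      rw [Finset.mem_filter] at hc
      rw [hL, ← hc.2, Nat.Partition.ofComposition_parts]
    · intro c _ c' _ h
      exact Composition.ext h
    · intro b hb
      rw [hL] at hb
      refine ⟨⟨b, fun {i} hi => p.parts_pos (by rw [← hb]; exact hi), ?_⟩, ?_, rfl⟩
      · rw [← Multiset.sum_coe, hb, p.parts_sum]
      · simp only [Finset.mem_filter, Finset.mem_univ, true_and]
        exact Nat.Partition.ext hb
  rw [h1, multinomialCoeff, eq_div_iff, ← hcard]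
  · push_cast; rfl
  · exact Finset.prod_ne_zero_iff.2 fun n _ => by exact_mod_cast Nat.factorial_ne_zero _

/-- A sum over compositions of a quantity that does not depend on the order of the blocks is a sum
over partitions, weighted by multinomial coefficients. -/
theorem sum_composition_eq_sum_partition (l : ℕ) (q x : ℕ → ℂ) :
    ∑ c : Composition l, q c.length * (c.blocks.map x).prod
      = ∑ p : Nat.Partition l, q (Multiset.card p.parts) * multinomialCoeff p
          * ∏ n ∈ p.parts.toFinset, x n ^ p.parts.count n := by
  rw [← Finset.sum_fiberwise (s := Finset.univ) (g := fun c => Nat.Partition.ofComposition l c)]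
  refine Finset.sum_congr rfl fun p _ => ?_
  rw [← card_filter_ofComposition, mul_right_comm, mul_comm _ ((Finset.card _ : ℕ) : ℂ),
    ← nsmul_eq_mul]
  refine Finset.sum_eq_card_nsmul fun c hc => ?_
  have hc' : p.parts = (c.blocks : Multiset ℕ) := by
    rw [← (Finset.mem_filter.1 hc).2, Nat.Partition.ofComposition_parts]
  rw [← Finset.prod_multiset_map_count, hc', Multiset.map_coe, Multiset.prod_coe,
    Multiset.coe_card]

/-- The coefficients of a composition of power series, as sums over partitions. -/
theorem HasTaylorAtZero.comp {g b : ℂ → ℂ} {q x : ℕ → ℂ} (hg : HasTaylorAtZero g q)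
    (hb : HasTaylorAtZero b x) (h0 : b 0 = 0) :
    HasTaylorAtZero (g ∘ b) fun l => ∑ p : Nat.Partition l,
      q (Multiset.card p.parts) * multinomialCoeff p
        * ∏ n ∈ p.parts.toFinset, x n ^ p.parts.count n := by
  rw [hasTaylorAtZero_iff] at hg hb
  have h := HasFPowerSeriesAt.comp (g := g) (q := FormalMultilinearSeries.ofScalars ℂ q)
    (by rwa [h0]) hb
  rw [hasFPowerSeriesAt_iff] at h
  filter_upwards [h] with w hw
  rw [zero_add] at hw
  convert! hw using 2 with l
  rw [smul_eq_mul, mul_comm, ← sum_composition_eq_sum_partition]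
  congr 1
  rw [FormalMultilinearSeries.coeff, FormalMultilinearSeries.comp,
    sum_apply]
  refine Finset.sum_congr rfl fun c _ => ?_
  rw [FormalMultilinearSeries.compAlongComposition_apply,
    FormalMultilinearSeries.apply_eq_prod_smul_coeff, FormalMultilinearSeries.coeff_ofScalars,
    smul_eq_mul, mul_comm]
  congr 1
  rw [← c.ofFn_blocksFun, List.map_ofFn, List.prod_ofFn]
  refine Finset.prod_congr rfl fun i _ => ?_
  simp [FormalMultilinearSeries.applyComposition,
    FormalMultilinearSeries.apply_eq_prod_smul_coeff, FormalMultilinearSeries.coeff_ofScalars]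

/-! ### Injective holomorphic functions -/

section Injective

variable {f : ℂ → ℂ} {U : Set ℂ} {z : ℂ}

theorem Set.InjOn.nhds_le_map_nhds (hU : IsOpen U) (hf : DifferentiableOn ℂ f U)
    (hinj : InjOn f U) (hz : z ∈ U) : 𝓝 (f z) ≤ map f (𝓝 z) := by
  refine ((hf.analyticAt (hU.mem_nhds hz)).eventually_constant_or_nhds_le_map_nhds).resolve_left
    fun h => ?_
  have h1 : ∀ᶠ w in 𝓝[≠] z, w ∈ U ∧ f w = f z ∧ w ≠ z := by
    filter_upwards [mem_nhdsWithin_of_mem_nhds (hU.mem_nhds hz), mem_nhdsWithin_of_mem_nhds h,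
      self_mem_nhdsWithin] with w h1 h2 h3 using ⟨h1, h2, h3⟩
  obtain ⟨w, hw, hfw, hne⟩ := h1.exists
  exact hne (hinj hw hz hfw)

theorem Set.InjOn.continuousAt_invFunOn (hU : IsOpen U) (hf : DifferentiableOn ℂ f U)
    (hinj : InjOn f U) (hz : z ∈ U) : ContinuousAt (Function.invFunOn f U) (f z) := by
  have hl := hinj.leftInvOn_invFunOn
  rw [ContinuousAt, hl hz]
  refine (Filter.map_mono (hinj.nhds_le_map_nhds hU hf hz)).trans ?_
  rw [Filter.map_map, Filter.map_congr (m₂ := id), Filter.map_id]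
  filter_upwards [hU.mem_nhds hz] with w hw using hl hw

theorem Set.InjOn.eventually_right_inverse (hU : IsOpen U) (hf : DifferentiableOn ℂ f U)
    (hinj : InjOn f U) (hz : z ∈ U) : ∀ᶠ y in 𝓝 (f z), f (Function.invFunOn f U y) = y := by
  filter_upwards [hinj.nhds_le_map_nhds hU hf hz (image_mem_map (hU.mem_nhds hz))] with y hy
  exact Function.invFunOn_eq hy

theorem Set.InjOn.hasDerivAt_invFunOn (hU : IsOpen U) (hf : DifferentiableOn ℂ f U)
    (hinj : InjOn f U) (hz : z ∈ U) (h : deriv f z ≠ 0) :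
    HasDerivAt (Function.invFunOn f U) (deriv f z)⁻¹ (f z) := by
  refine HasDerivAt.of_local_left_inverse (hinj.continuousAt_invFunOn hU hf hz) ?_ h
    (hinj.eventually_right_inverse hU hf hz)
  rw [hinj.leftInvOn_invFunOn hz]
  exact (hf.differentiableAt (hU.mem_nhds hz)).hasDerivAt

/-- The inverse is continuous, and holomorphic away from the images of the isolated zeros of the
derivative. Those singularities are removable, so the derivative has no zeros by the chain rule. -/
theorem Set.InjOn.deriv_ne_zero (hU : IsOpen U) (hf : DifferentiableOn ℂ f U)
    (hinj : InjOn f U) (hz : z ∈ U) : deriv f z ≠ 0 := by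
  set g := Function.invFunOn f U with hg
  have hfa : AnalyticAt ℂ f z := hf.analyticAt (hU.mem_nhds hz)
  have hne : ∀ᶠ w in 𝓝[≠] z, deriv f w ≠ 0 := by
    refine hfa.deriv.eventually_eq_zero_or_eventually_ne_zero.resolve_left fun h0 => ?_
    obtain ⟨r, hr, hb⟩ := Metric.eventually_nhds_iff_ball.1 (h0.and (hU.mem_nhds hz))
    have hconst : ∀ w ∈ Metric.ball z r, f w = f z := fun w hw =>
      Metric.isOpen_ball.is_const_of_deriv_eq_zero (convex_ball z r).isPreconnected
        (hf.mono fun w hw => (hb w hw).2) (fun w hw => (hb w hw).1) hw (Metric.mem_ball_self hr)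
    have hev : ∀ᶠ w in 𝓝[≠] z, w ∈ Metric.ball z r ∧ w ≠ z :=
      (eventually_nhdsWithin_of_eventually_nhds (Metric.ball_mem_nhds z hr)).and
        self_mem_nhdsWithin
    obtain ⟨w, hw, hwz⟩ := hev.exists
    exact hwz (hinj (hb w hw).2 hz (hconst w hw))
  obtain ⟨V, hVo, hzV, hV⟩ : ∃ V, IsOpen V ∧ z ∈ V ∧ ∀ w ∈ V, w ∈ U ∧ (w ≠ z → deriv f w ≠ 0) := by
    rw [eventually_nhdsWithin_iff] at hne
    obtain ⟨V, hV, hVo, hzV⟩ := eventually_nhds_iff.1 ((hU.eventually_mem hz).and hne)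
    exact ⟨V, hVo, hzV, hV⟩
  have himg : f '' V ∈ 𝓝 (f z) :=
    hinj.nhds_le_map_nhds hU hf hz (image_mem_map (hVo.mem_nhds hzV))
  have hd : DifferentiableOn ℂ g (f '' V \ {f z}) := by
    rintro _ ⟨⟨w, hw, rfl⟩, hne'⟩
    exact (hinj.hasDerivAt_invFunOn hU hf (hV w hw).1
      ((hV w hw).2 fun h => hne' (by rw [h]; rfl))).differentiableAt.differentiableWithinAt
  have hdz : DifferentiableAt ℂ g (f z) :=
    ((Complex.differentiableOn_compl_singleton_and_continuousAt_iff himg).1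
      ⟨hd, hinj.continuousAt_invFunOn hU hf hz⟩).differentiableAt himg
  have hcomp : HasDerivAt (g ∘ f) (deriv g (f z) * deriv f z) z :=
    hdz.hasDerivAt.comp z hfa.differentiableAt.hasDerivAt
  have hid : HasDerivAt (g ∘ f) 1 z := by
    refine (hasDerivAt_id z).congr_of_eventuallyEq ?_
    filter_upwards [hU.mem_nhds hz] with w hw using hinj.leftInvOn_invFunOn hw
  intro h0
  have := hcomp.unique hid
  simp [h0] at this

end Injective

/-! ### The exterior conformal map near infinity -/

/-- The exterior of the closed unit disk. -/
def exteriorDisk : Set ℂ := {ζ | 1 < ‖ζ‖}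

theorem isOpen_exteriorDisk : IsOpen exteriorDisk := isOpen_lt continuous_const continuous_norm

theorem isOpen_exteriorOf (Ω : Set ℂ) : IsOpen (exteriorOf Ω) := isClosed_closure.isOpen_compl

/-- The inverse of the exterior conformal map; its values off the exterior domain are arbitrary. -/
noncomputable def exteriorInv (Φ : ℂ → ℂ) : ℂ → ℂ := Function.invFunOn Φ exteriorDisk

/-- The function `w ↦ 1 / Φ (1 / w)`. It extends holomorphically to the origin by the value `0`; the
value given to it there by this definition is meaningless. -/
noncomputable def invAtInfinity (Φ : ℂ → ℂ) (w : ℂ) : ℂ := (Φ w⁻¹)⁻¹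

namespace IsExteriorConformalMap

variable {Ω : Set ℂ} {Φ : ℂ → ℂ} {c : ℝ} {μ : ℕ → ℂ}

theorem c_ne_zero (h : IsExteriorConformalMap Ω Φ c μ) : (c : ℂ) ≠ 0 := by
  exact_mod_cast h.pos.ne'

theorem hasSum_of_norm_lt_one (h : IsExteriorConformalMap Ω Φ c μ) {w : ℂ} (hw : w ≠ 0)
    (hw1 : ‖w‖ < 1) : HasSum (fun l : ℕ => μ l * w ^ l) (Φ w⁻¹ - c * w⁻¹) := by
  have := h.expansion w⁻¹ (by
    rw [norm_inv]; exact (one_lt_inv₀ (norm_pos_iff.2 hw)).2 hw1)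
  simpa [div_eq_mul_inv] using this

/-- The power series of `w ↦ w Φ (1 / w) - c`. -/
theorem hasTaylorAtZero_mul_sub (h : IsExteriorConformalMap Ω Φ c μ) :
    HasTaylorAtZero (fun w => if w = 0 then 0 else w * Φ w⁻¹ - c)
      (fun n => if n = 0 then 0 else μ (n - 1)) := by
  filter_upwards [Metric.ball_mem_nhds (0 : ℂ) one_pos] with w hw
  rw [← hasSum_nat_add_iff' 1]
  by_cases h0 : w = 0
  · subst h0; simp [hasSum_zero]
  · rw [if_neg h0]
    have h1 := (h.hasSum_of_norm_lt_one h0 (by simpa using hw)).mul_left w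
    convert! h1 using 1
    · ext n; simp; ring
    · simp; field_simp

/-- From `1 / Φ (1 / w) = (w / c) / (1 + y / c)` with `y = w Φ (1 / w) - c`: the geometric series in
`y / c` is composed with the power series of `y`. -/
theorem hasTaylorAtZero_invAtInfinity (h : IsExteriorConformalMap Ω Φ c μ) :
    HasTaylorAtZero (fun w => if w = 0 then 0 else invAtInfinity Φ w) (coeffB c μ) := by
  have hc := h.c_ne_zero
  have hq : HasTaylorAtZero (fun y => (1 + y / c)⁻¹) (fun n => (-1 / (c : ℂ)) ^ n) := by
    filter_upwards [Metric.ball_mem_nhds (0 : ℂ) h.pos] with y hy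
    have hy' : ‖-1 / (c : ℂ) * y‖ < 1 := by
      rw [norm_mul, norm_div, norm_neg, norm_one, Complex.norm_real, Real.norm_of_nonneg h.pos.le,
        one_div, inv_mul_lt_one₀ h.pos]
      simpa using hy
    have h2 := hasSum_geometric_of_norm_lt_one hy'
    simp only [mul_pow] at h2
    convert! h2 using 2
    ring
  have h3 := hq.comp h.hasTaylorAtZero_mul_sub (by simp)
  filter_upwards [h3] with w hw
  rw [← hasSum_nat_add_iff' 1]
  have h4 := hw.mul_left (w / c)
  convert! h4 using 1
  · ext k
    simp only [coeffB]
    have : ∀ p : Nat.Partition k, ∏ n ∈ p.parts.toFinset, μ (n - 1) ^ p.parts.count n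
        = ∏ n ∈ p.parts.toFinset, (if n = 0 then 0 else μ (n - 1)) ^ p.parts.count n := by
      intro p
      refine Finset.prod_congr rfl fun n hn => ?_
      rw [if_neg (p.parts_pos (Multiset.mem_toFinset.1 hn)).ne']
    simp only [this]
    ring
  · split_ifs with h0
    · simp [h0, coeffB]
    · simp only [Finset.range_one, Finset.sum_singleton, coeffB, zero_mul, sub_zero, invAtInfinity,
        Function.comp, if_neg h0]
      have : 1 + (w * Φ w⁻¹ - c) / c = w * Φ w⁻¹ / c := by field_simp; ring
      rw [this, inv_div, mul_div, div_mul_cancel₀ _ hc]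
      by_cases h5 : Φ w⁻¹ = 0
      · simp [h5]
      · field_simp

theorem deriv_ne_zero (h : IsExteriorConformalMap Ω Φ c μ) {ζ : ℂ} (hζ : ζ ∈ exteriorDisk) :
    deriv Φ ζ ≠ 0 :=
  h.bijective.injOn.deriv_ne_zero isOpen_exteriorDisk h.holomorphic hζ

theorem exteriorInv_apply (h : IsExteriorConformalMap Ω Φ c μ) {ζ : ℂ} (hζ : ζ ∈ exteriorDisk) :
    exteriorInv Φ (Φ ζ) = ζ :=
  h.bijective.injOn.leftInvOn_invFunOn hζ

theorem exteriorInv_mem (h : IsExteriorConformalMap Ω Φ c μ) {z : ℂ} (hz : z ∈ exteriorOf Ω) :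
    exteriorInv Φ z ∈ exteriorDisk :=
  Function.invFunOn_mem (h.bijective.surjOn hz)

theorem apply_exteriorInv (h : IsExteriorConformalMap Ω Φ c μ) {z : ℂ} (hz : z ∈ exteriorOf Ω) :
    Φ (exteriorInv Φ z) = z :=
  Function.invFunOn_eq (h.bijective.surjOn hz)

theorem differentiableOn_exteriorInv (h : IsExteriorConformalMap Ω Φ c μ) :
    DifferentiableOn ℂ (exteriorInv Φ) (exteriorOf Ω) := by
  intro z hz
  have hm := h.exteriorInv_mem hz
  have := h.bijective.injOn.hasDerivAt_invFunOn isOpen_exteriorDisk h.holomorphic hm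
    (h.deriv_ne_zero hm)
  rw [h.apply_exteriorInv hz] at this
  exact this.differentiableAt.differentiableWithinAt

/-- The preimages of bounded sets are bounded, as `|Φ ζ| ≥ c |ζ| / 2` for large `ζ`. -/
theorem exists_norm_le (h : IsExteriorConformalMap Ω Φ c μ) (R : ℝ) :
    ∃ M, ∀ ζ ∈ exteriorDisk, ‖Φ ζ‖ < R → ‖ζ‖ ≤ M := by
  have hcont := h.hasTaylorAtZero_mul_sub.analyticAt.continuousAt
  obtain ⟨δ, hδ, hb⟩ := Metric.continuousAt_iff.1 hcont (c / 2) (half_pos h.pos)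
  refine ⟨max δ⁻¹ (2 * R / c), fun ζ hζ hR => ?_⟩
  by_contra! hlt
  rw [max_lt_iff] at hlt
  have h0 : ζ ≠ 0 := by rintro rfl; simp [exteriorDisk] at hζ; linarith
  have h1 := hb (x := ζ⁻¹) (by
    rw [dist_zero_right, norm_inv]; exact inv_lt_of_inv_lt₀ hδ hlt.1)
  simp only [inv_eq_zero, h0, if_false, if_true, dist_zero_right, inv_inv] at h1
  have h2 : c / 2 < ‖ζ⁻¹ * Φ ζ‖ := by
    have h3 : ‖(c : ℂ)‖ ≤ ‖ζ⁻¹ * Φ ζ‖ + ‖ζ⁻¹ * Φ ζ - c‖ := by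
      have := norm_sub_le (ζ⁻¹ * Φ ζ) (ζ⁻¹ * Φ ζ - c)
      simpa using this
    rw [Complex.norm_real, Real.norm_of_nonneg h.pos.le] at h3
    linarith
  have h4 : 0 < ‖ζ‖ := norm_pos_iff.2 h0
  rw [norm_mul, norm_inv, inv_mul_eq_div, lt_div_iff₀ h4] at h2
  have h5 := hlt.2
  rw [div_lt_iff₀ h.pos] at h5
  linarith

/-- Near infinity, the inverse of the conformal map is `z ↦ 1 / κ (1 / z)` with `κ` holomorphic at
the origin, namely the local inverse of `invAtInfinity Φ`. -/
theorem exists_inverse_germ (h : IsExteriorConformalMap Ω Φ c μ) :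
    ∃ κ : ℂ → ℂ, AnalyticAt ℂ κ 0 ∧ κ 0 = 0 ∧
      (∀ᶠ w in 𝓝[≠] 0, κ (invAtInfinity Φ w) = w) ∧
      ∀ᶠ z in cobounded ℂ, exteriorInv Φ z = (κ z⁻¹)⁻¹ ∧ κ z⁻¹ ≠ 0 := by
  set k : ℂ → ℂ := fun w => if w = 0 then 0 else invAtInfinity Φ w with hk
  have hT := h.hasTaylorAtZero_invAtInfinity
  have hka : AnalyticAt ℂ k 0 := hT.analyticAt
  have hk0 : k 0 = 0 := by simp [hk]
  have hk' : deriv k 0 ≠ 0 := by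
    rw [(hasTaylorAtZero_iff.1 hT).deriv]
    simpa [coeffB, multinomialCoeff, FormalMultilinearSeries.ofScalars] using! h.pos.ne'
  set κ := hka.hasStrictDerivAt.localInverse k _ 0 hk' with hκ
  have hκa : AnalyticAt ℂ κ 0 := by
    have := hka.analyticAt_localInverse hk'
    rwa [hk0] at this
  have hκ0 : κ 0 = 0 := by
    have : κ (k 0) = 0 := HasStrictFDerivAt.localInverse_apply_image ..
    rwa [hk0] at this
  have hl : ∀ᶠ w in 𝓝 0, κ (k w) = w := HasStrictDerivAt.eventually_left_inverse ..
  have hr : ∀ᶠ x in 𝓝 0, k (κ x) = x := by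
    have : ∀ᶠ x in 𝓝 (k 0), k (κ x) = x := HasStrictDerivAt.eventually_right_inverse ..
    rwa [hk0] at this
  refine ⟨κ, hκa, hκ0, ?_, ?_⟩
  · filter_upwards [eventually_nhdsWithin_of_eventually_nhds hl, self_mem_nhdsWithin] with w hw hw0
    simpa [hk, show w ≠ 0 from hw0] using hw
  · have hsmall : ∀ᶠ x in 𝓝 (0 : ℂ), ‖κ x‖ < 1 := by
      have : Tendsto (fun x => ‖κ x‖) (𝓝 0) (𝓝 0) := by
        simpa [hκ0] using hκa.continuousAt.norm.tendsto
      exact this.eventually (gt_mem_nhds one_pos)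
    have hev := (tendsto_inv₀_cobounded (α := ℂ)).eventually (hr.and hsmall)
    filter_upwards [hev, eventually_ne_cobounded (0 : ℂ)] with z ⟨h1, h2⟩ hz
    have hne : κ z⁻¹ ≠ 0 := by
      intro h0
      rw [h0, hk0] at h1
      exact hz (by simpa using h1.symm)
    refine ⟨?_, hne⟩
    have h3 : Φ (κ z⁻¹)⁻¹ = z := by
      simpa [hk, hne, invAtInfinity] using h1
    conv_lhs => rw [← h3]
    refine h.exteriorInv_apply ?_
    rw [exteriorDisk, mem_ofPred, norm_inv]
    exact (one_lt_inv₀ (norm_pos_iff.2 hne)).2 h2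

theorem eventually_mem_exteriorOf (hΩ : IsBounded Ω) : ∀ᶠ z in cobounded ℂ, z ∈ exteriorOf Ω :=
  hΩ.closure

end IsExteriorConformalMap

/-! ### Uniqueness of multipolar expansions -/

/-- For `n ≥ 1` the imaginary part of `((3 + 4i) / 5) ^ n` is a nonzero integer divided by `5 ^ n`,
since `(3 + 4i) ^ n` is congruent to `3 + 4i` modulo `5`. -/
theorem inv_pow_le_abs_im_pow (n : ℕ) :
    (5⁻¹ : ℝ) ^ (n + 1) ≤ |((((3 : ℂ) + 4 * Complex.I) / 5) ^ (n + 1)).im| := by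
  have h : ∀ n : ℕ, ∃ p q : ℤ, ((3 : ℂ) + 4 * Complex.I) ^ (n + 1)
      = (5 * p + 3) + (5 * q + 4) * Complex.I := by
    intro n
    induction n with
    | zero => exact ⟨0, 0, by simp⟩
    | succ n ih =>
      obtain ⟨p, q, hpq⟩ := ih
      refine ⟨3 * p - 4 * q - 2, 3 * q + 4 * p + 4, ?_⟩
      rw [pow_succ, hpq]
      push_cast
      linear_combination (20 * (q : ℂ) + 16) * Complex.I_sq
  obtain ⟨p, q, hpq⟩ := h n
  have h5 : (((3 : ℂ) + 4 * Complex.I) / 5) ^ (n + 1)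
      = ((5⁻¹ ^ (n + 1) : ℝ) : ℂ)
        * (((5 * p + 3 : ℤ) : ℝ) + ((5 * q + 4 : ℤ) : ℝ) * Complex.I) := by
    rw [div_pow, hpq]
    push_cast
    rw [div_eq_mul_inv, mul_comm, inv_pow]
  rw [h5, Complex.im_ofReal_mul, abs_mul,
    abs_of_nonneg (by positivity)]
  refine le_mul_of_one_le_right (by positivity) ?_
  have h6 : (((((5 * p + 3 : ℤ) : ℝ) : ℂ) + ((5 * q + 4 : ℤ) : ℝ) * Complex.I)).im
      = ((5 * q + 4 : ℤ) : ℝ) := by simp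
  rw [h6, ← Int.cast_abs]
  exact_mod_cast Int.one_le_abs (by omega)

/-- If the real part of a formal power series converges to `0` at every point near the origin, all
coefficients of positive degree vanish. Convergence along the directions `1` and `(3 + 4i) / 5`
bounds the coefficients geometrically, so that the full series converges too. -/
theorem eq_zero_of_hasSum_re {b : ℕ → ℂ}
    (h : ∀ᶠ x in 𝓝 (0 : ℂ), HasSum (fun n : ℕ => (b n * x ^ n).re) 0) {n : ℕ} (hn : n ≠ 0) :
    b n = 0 := by
  obtain ⟨δ, hδ, hb⟩ := Metric.eventually_nhds_iff_ball.1 h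
  set t : ℝ := δ / 2 with ht
  have ht0 : 0 < t := half_pos hδ
  set e : ℂ := ((3 : ℂ) + 4 * Complex.I) / 5 with he
  have hen : ‖e‖ = 1 := by
    rw [← sq_eq_sq₀ (norm_nonneg _) zero_le_one, ← Complex.normSq_eq_norm_sq, he,
      Complex.normSq_apply]
    norm_num
  have bound : ∀ v : ℂ, ‖v‖ = 1 → ∃ C, ∀ n : ℕ, |(b n * v ^ n).re| * t ^ n ≤ C := by
    intro v hv
    have h1 := hb (t * v) (by
      rw [mem_ball_zero_iff, norm_mul, hv, Complex.norm_real, Real.norm_of_nonneg ht0.le]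
      linarith)
    obtain ⟨C, hC⟩ := h1.summable.tendsto_atTop_zero.norm.bddAbove_range
    refine ⟨C, fun n => ?_⟩
    have h2 : ‖(b n * (t * v) ^ n).re‖ ≤ C := hC ⟨n, rfl⟩
    rw [show b n * ((t : ℂ) * v) ^ n = ((t ^ n : ℝ) : ℂ) * (b n * v ^ n) by push_cast; ring,
      Complex.re_ofReal_mul, norm_mul, Real.norm_of_nonneg (by positivity), mul_comm] at h2
    exact h2
  obtain ⟨C₁, h₁⟩ := bound 1 norm_one
  obtain ⟨C₂, h₂⟩ := bound e hen
  simp only [one_pow, mul_one] at h₁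
  have hre : ∀ m : ℕ, |(e ^ m).re| ≤ 1 := fun m =>
    (Complex.abs_re_le_norm _).trans (by rw [norm_pow, hen, one_pow])
  have hC₁ : 0 ≤ C₁ := le_trans (by positivity) (h₁ 0)
  have hC₂ : 0 ≤ C₂ := le_trans (by positivity) (h₂ 0)
  have hbd : ∀ m : ℕ, ‖b (m + 1)‖ * (t / 5) ^ (m + 1) ≤ 2 * C₁ + C₂ := by
    intro m
    have hp : (t / 5) ^ (m + 1) ≤ t ^ (m + 1) := pow_le_pow_left₀ (by positivity) (by linarith) _
    have k1 : |(b (m + 1)).re| * (t / 5) ^ (m + 1) ≤ C₁ :=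
      (mul_le_mul_of_nonneg_left hp (abs_nonneg _)).trans (h₁ _)
    have k2 : |(b (m + 1)).im| * (t / 5) ^ (m + 1) ≤ C₁ + C₂ := by
      have k3 : |(b (m + 1)).im| * |(e ^ (m + 1)).im|
          ≤ |(b (m + 1)).re| + |(b (m + 1) * e ^ (m + 1)).re| := by
        rw [← abs_mul, Complex.mul_re]
        have := abs_sub ((b (m + 1)).re * (e ^ (m + 1)).re)
          ((b (m + 1)).re * (e ^ (m + 1)).re - (b (m + 1)).im * (e ^ (m + 1)).im)
        rw [sub_sub_cancel] at this
        refine this.trans (add_le_add_left ?_ _)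
        rw [abs_mul]
        exact mul_le_of_le_one_right (abs_nonneg _) (hre _)
      calc |(b (m + 1)).im| * (t / 5) ^ (m + 1)
          = |(b (m + 1)).im| * 5⁻¹ ^ (m + 1) * t ^ (m + 1) := by
            rw [div_eq_mul_inv, mul_pow]; ring
        _ ≤ |(b (m + 1)).im| * |(e ^ (m + 1)).im| * t ^ (m + 1) := by
            gcongr
            exact inv_pow_le_abs_im_pow m
        _ ≤ (|(b (m + 1)).re| + |(b (m + 1) * e ^ (m + 1)).re|) * t ^ (m + 1) := by gcongr
        _ ≤ C₁ + C₂ := by rw [add_mul]; exact add_le_add (h₁ _) (h₂ _)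
    calc ‖b (m + 1)‖ * (t / 5) ^ (m + 1)
        ≤ (|(b (m + 1)).re| + |(b (m + 1)).im|) * (t / 5) ^ (m + 1) := by
          gcongr
          exact Complex.norm_le_abs_re_add_abs_im _
      _ ≤ 2 * C₁ + C₂ := by rw [add_mul]; linarith
  have hT : HasTaylorAtZero (fun x => ∑' n : ℕ, b n * x ^ n) b := by
    filter_upwards [Metric.ball_mem_nhds (0 : ℂ) (show 0 < t / 10 by positivity)] with x hx
    refine Summable.hasSum ?_
    rw [← summable_nat_add_iff 1]
    refine Summable.of_norm_bounded (g := fun m : ℕ => (2 * C₁ + C₂) * (1 / 2) ^ (m + 1)) ?_ ?_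
    · exact ((summable_nat_add_iff 1).2 summable_geometric_two).mul_left _
    · intro m
      rw [norm_mul, norm_pow]
      have hx' : ‖x‖ ≤ t / 5 * (1 / 2) := by
        have := mem_ball_zero_iff.1 hx
        linarith
      calc ‖b (m + 1)‖ * ‖x‖ ^ (m + 1) ≤ ‖b (m + 1)‖ * (t / 5 * (1 / 2)) ^ (m + 1) := by gcongr
        _ = ‖b (m + 1)‖ * (t / 5) ^ (m + 1) * (1 / 2) ^ (m + 1) := by rw [mul_pow]; ring
        _ ≤ _ := by gcongr; exact hbd m
  -- A holomorphic function with vanishing real part is constant near the origin.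
  set f : ℂ → ℂ := fun x => ∑' n : ℕ, b n * x ^ n with hf
  have hev : ∀ᶠ x in 𝓝 (0 : ℂ), AnalyticAt ℂ f x ∧ (f x).re = 0 := by
    filter_upwards [hT.analyticAt.eventually_analyticAt, hT, h] with x h1 h2 h3
    exact ⟨h1, (Complex.hasSum_re h2).unique h3⟩
  obtain ⟨r, hr, hball⟩ := Metric.eventually_nhds_iff_ball.1 hev
  obtain ⟨C, hC⟩ := AnalyticOnNhd.eq_const_of_re_eq_const (fun x hx => (hball x hx).1)
    (fun x hx => (hball x hx).2) Metric.isOpen_ball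
    ((convex_ball (0 : ℂ) r).isConnected ⟨0, Metric.mem_ball_self hr⟩)
  have hT' : HasTaylorAtZero f (fun n => if n = 0 then C else 0) := by
    filter_upwards [Metric.ball_mem_nhds (0 : ℂ) hr] with x hx
    rw [hC x hx]
    convert! hasSum_single (f := fun n : ℕ => (if n = 0 then C else 0) * x ^ n) 0
      (fun n hn => by simp [hn]) using 1
    simp
  rw [hT.unique hT']
  simp [hn]

theorem re_mul_inv_pow (b z : ℂ) (m : ℕ) :
    (b * z⁻¹ ^ m).re = (b.re * Real.cos (m * z.arg) + b.im * Real.sin (m * z.arg)) / ‖z‖ ^ m := by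
  have h : z⁻¹ ^ m = ((‖z‖ ^ m)⁻¹ : ℝ)
      * (Complex.cos ((m * z.arg : ℝ)) - Complex.sin ((m * z.arg : ℝ)) * Complex.I) := by
    have h1 : Complex.cos ((m * z.arg : ℝ)) - Complex.sin ((m * z.arg : ℝ)) * Complex.I
        = (Complex.exp (z.arg * Complex.I))⁻¹ ^ m := by
      rw [← Complex.exp_neg, ← Complex.exp_nat_mul, show (m : ℂ) * -(z.arg * Complex.I)
        = ((-(m * z.arg) : ℝ) : ℂ) * Complex.I by push_cast; ring, Complex.exp_mul_I]
      push_cast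
      rw [Complex.cos_neg, Complex.sin_neg]
      ring
    rw [h1]
    conv_lhs => rw [← Complex.norm_mul_exp_arg_mul_I z]
    push_cast
    rw [mul_inv, mul_pow, inv_pow]
  rw [h, Complex.mul_re, Complex.re_ofReal_mul, Complex.im_ofReal_mul, ← Complex.ofReal_cos,
    ← Complex.ofReal_sin]
  simp only [Complex.sub_re, Complex.sub_im, Complex.ofReal_re, Complex.ofReal_im,
    Complex.re_ofReal_mul, Complex.im_ofReal_mul, Complex.I_re, Complex.I_im]
  ring

/-- The complex coefficients `bₘ` for which the multipolar expansion with coefficients `A` is the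
real part of `∑ bₘ z⁻ᵐ`. -/
noncomputable def multipoleCoeff (A : Trig → ℕ → ℝ) (m : ℕ) : ℂ :=
  -(A .c m + A .s m * Complex.I) / (2 * Real.pi * m)

theorem re_multipoleCoeff_mul (A : Trig → ℕ → ℝ) (z : ℂ) (i : ℕ) :
    -((A .c (i + 1) * Real.cos ((i + 1 : ℕ) * z.arg)
        + A .s (i + 1) * Real.sin ((i + 1 : ℕ) * z.arg))
          / (2 * Real.pi * (i + 1 : ℕ) * ‖z‖ ^ (i + 1)))
      = (multipoleCoeff A (i + 1) * z⁻¹ ^ (i + 1)).re := by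
  have h : multipoleCoeff A (i + 1)
      = ((-(2 * Real.pi * (i + 1 : ℕ))⁻¹ : ℝ) : ℂ) * (A .c (i + 1) + A .s (i + 1) * Complex.I) := by
    rw [multipoleCoeff]
    push_cast
    rw [div_eq_mul_inv]
    ring
  rw [re_mul_inv_pow, h, Complex.re_ofReal_mul, Complex.im_ofReal_mul, ← div_div, ← neg_div]
  congr 1
  simp only [Complex.add_re, Complex.add_im, Complex.ofReal_re, Complex.ofReal_im,
    Complex.re_ofReal_mul, Complex.im_ofReal_mul, Complex.I_re, Complex.I_im]
  ring

theorem multipolar_unique {A A' : Trig → ℕ → ℝ} {f : ℂ → ℝ}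
    (h : ∀ᶠ z in cobounded ℂ, HasSum
      (fun i : ℕ => (multipoleCoeff A (i + 1) * z⁻¹ ^ (i + 1)).re) (f z))
    (h' : ∀ᶠ z in cobounded ℂ, HasSum
      (fun i : ℕ => (multipoleCoeff A' (i + 1) * z⁻¹ ^ (i + 1)).re) (f z))
    (α : Trig) {m : ℕ} (hm : 1 ≤ m) : A α m = A' α m := by
  set b : ℕ → ℂ := fun n => if n = 0 then 0 else multipoleCoeff A n - multipoleCoeff A' n with hb
  have hz : ∀ᶠ x in 𝓝 (0 : ℂ), HasSum (fun n : ℕ => (b n * x ^ n).re) 0 := by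
    have h1 := tendsto_inv₀_nhdsNE_zero.eventually (h.and h')
    rw [eventually_nhdsWithin_iff] at h1
    filter_upwards [h1] with x hx
    by_cases hx0 : x = 0
    · subst hx0
      have : (fun n : ℕ => (b n * 0 ^ n).re) = fun _ => 0 := by
        ext n
        by_cases hn : n = 0 <;> simp [hb, hn]
      rw [this]
      exact hasSum_zero
    · obtain ⟨h2, h3⟩ := hx hx0
      rw [← hasSum_nat_add_iff' 1]
      convert! h2.sub h3 using 1
      · ext i
        simp [hb, sub_mul]
      · simp [hb]
  have h0 := eq_zero_of_hasSum_re hz (n := m) (by omega)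
  simp only [hb, if_neg (show m ≠ 0 by omega), multipoleCoeff] at h0
  have hm' : (2 * (Real.pi : ℂ) * m) ≠ 0 := by
    have : (m : ℂ) ≠ 0 := by exact_mod_cast (show m ≠ 0 by omega)
    have := Real.pi_ne_zero
    simp_all
  rw [← sub_div, div_eq_zero_iff, or_iff_left hm'] at h0
  have hre := congrArg Complex.re h0
  have him := congrArg Complex.im h0
  simp at hre him
  cases α <;> linarith

/-! ### Uniqueness for the exterior Neumann problem -/

theorem norm_gradient_eq (f : ℂ → ℝ) (z : ℂ) : ‖∇ f z‖ = ‖fderiv ℝ f z‖ :=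
  (InnerProductSpace.toDual ℝ ℂ).symm.norm_map _

theorem gradient_sub {f g : ℂ → ℝ} {z : ℂ} (hf : DifferentiableAt ℝ f z)
    (hg : DifferentiableAt ℝ g z) : ∇ (fun x => f x - g x) z = ∇ f z - ∇ g z := by
  rw [gradient, fderiv_fun_sub hf hg, map_sub]
  rfl

theorem gradient_mul {f g : ℂ → ℝ} {z : ℂ} (hf : DifferentiableAt ℝ f z)
    (hg : DifferentiableAt ℝ g z) : ∇ (fun x => f x * g x) z = f z • ∇ g z + g z • ∇ f z := by
  rw [gradient, fderiv_fun_mul hf hg, map_add, map_smulₛₗ, map_smulₛₗ]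
  rfl

theorem continuousOn_gradient {f : ℂ → ℝ} {D : Set ℂ} (hD : IsOpen D) (hf : ContDiffOn ℝ 1 f D) :
    ContinuousOn (∇ f) D :=
  (InnerProductSpace.toDual ℝ ℂ).symm.continuous.comp_continuousOn
    (hf.continuousOn_fderiv_of_isOpen hD le_rfl)

theorem InnerProductSpace.HarmonicOnNhd.contDiffOn_infty {f : ℂ → ℝ} {D : Set ℂ}
    (hf : InnerProductSpace.HarmonicOnNhd f D) : ContDiffOn ℝ ∞ f D := fun z hz =>
  (HarmonicAt.analyticAt (hf z hz)).contDiffAt.contDiffWithinAt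

theorem IsExteriorTestFunction.gradient_eq_zero {Ω : Set ℂ} {v : ℂ → ℝ} {R : ℝ}
    (hR : ∀ z ∈ exteriorOf Ω, R ≤ ‖z‖ → v z = 0) {z : ℂ} (hz : z ∈ exteriorOf Ω) (hzR : R < ‖z‖) :
    ∇ v z = 0 := by
  have h : v =ᶠ[𝓝 z] fun _ => 0 := by
    filter_upwards [(isOpen_exteriorOf Ω).mem_nhds hz,
      (isOpen_lt continuous_const continuous_norm).mem_nhds hzR] with y h1 h2
    exact hR y h1 (le_of_lt h2)
  rw [gradient, h.fderiv_eq]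
  simp

theorem integrableOn_inner_gradient {Ω : Set ℂ} {u v : ℂ → ℝ} (hu : ContDiffOn ℝ 1 u (exteriorOf Ω))
    (hu2 : ∀ R : ℝ, IntegrableOn (fun z => ‖∇ u z‖ ^ 2) (exteriorOf Ω ∩ Metric.ball 0 R))
    (hv : IsExteriorTestFunction Ω v) :
    IntegrableOn (fun z => inner ℝ (∇ u z) (∇ v z)) (exteriorOf Ω) := by
  have hD := isOpen_exteriorOf Ω
  obtain ⟨R, hR⟩ := hv.bounded_support
  have hu3 := hu2 (R + 1)
  rw [inter_comm, IntegrableOn, ← Measure.restrict_restrict measurableSet_ball] at hu3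
  have hu4 := (integrable_indicator_iff measurableSet_ball).2 hu3
  refine Integrable.mono' (hu4.add hv.grad_sq_integrable) ?_ ?_
  · have hvc := continuousOn_gradient hD (hv.smooth.of_le (by simp))
    exact ((continuousOn_gradient hD hu).inner hvc).aestronglyMeasurable hD.measurableSet
  · refine (ae_restrict_iff' hD.measurableSet).2 (Eventually.of_forall fun z hz => ?_)
    by_cases hzR : z ∈ Metric.ball (0 : ℂ) (R + 1)
    · have h1 := norm_inner_le_norm (𝕜 := ℝ) (∇ u z) (∇ v z)
      simp only [Pi.add_apply, indicator_of_mem hzR]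
      nlinarith [sq_nonneg (‖∇ u z‖ - ‖∇ v z‖), sq_nonneg ‖∇ u z‖, sq_nonneg ‖∇ v z‖]
    · have h2 : R < ‖z‖ := by
        rw [mem_ball_zero_iff, not_lt] at hzR
        linarith
      simp [IsExteriorTestFunction.gradient_eq_zero hR hz h2, hzR]

theorem IsNeumannSolution.integrableOn_inner_gradient {Ω : Set ℂ} {h u v : ℂ → ℝ}
    (hu : IsNeumannSolution Ω h u) (hv : IsExteriorTestFunction Ω v) :
    IntegrableOn (fun z => inner ℝ (∇ u z) (∇ v z)) (exteriorOf Ω) :=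
  _root_.integrableOn_inner_gradient (hu.harmonic.contDiffOn_infty.of_le (by simp))
    hu.grad_sq_integrable hv

/-- Smooth cutoff functions at scale `R`, with gradient of order `1 / R`. -/
theorem exists_smooth_cutoff : ∃ L : ℝ, 0 ≤ L ∧ ∀ R : ℝ, 0 < R → ∃ χ : ℂ → ℝ, ContDiff ℝ ∞ χ ∧
    (∀ z, 0 ≤ χ z ∧ χ z ≤ 1) ∧ (∀ z, ‖z‖ ≤ R → χ z = 1) ∧ (∀ z, 2 * R ≤ ‖z‖ → χ z = 0) ∧
    (∀ z, ‖∇ χ z‖ ≤ L / R) ∧ (∀ z, ‖z‖ < R → ∇ χ z = 0) := by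
  let f : ContDiffBump (0 : ℂ) := ⟨1, 2, one_pos, one_lt_two⟩
  have hfs : ContDiff ℝ ∞ f := f.contDiff
  obtain ⟨L, hL⟩ := (hfs.continuous_fderiv (by simp)).bounded_above_of_compact_support
    (f.hasCompactSupport.fderiv (𝕜 := ℝ))
  refine ⟨L, (norm_nonneg _).trans (hL 0), fun R hR =>
    ⟨fun z => f (R⁻¹ • z), ?_, ?_, ?_, ?_, ?_, ?_⟩⟩
  · exact hfs.comp (contDiff_const_smul _)
  · exact fun z => ⟨f.nonneg, f.le_one⟩
  · intro z hz
    refine f.one_of_mem_closedBall ?_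
    rw [mem_closedBall_zero_iff, norm_smul, norm_inv, Real.norm_of_nonneg hR.le]
    exact (inv_mul_le_one₀ hR).2 hz
  · intro z hz
    refine f.zero_of_le_dist ?_
    rw [dist_zero_right, norm_smul, norm_inv, Real.norm_of_nonneg hR.le, inv_mul_eq_div,
      le_div_iff₀ hR]
    exact hz
  · intro z
    rw [norm_gradient_eq, fderiv_comp_smul, norm_smul, norm_inv, Real.norm_of_nonneg hR.le,
      inv_mul_eq_div]
    gcongr
    exact hL _
  · intro z hz
    have h : (fun z => f (R⁻¹ • z)) =ᶠ[𝓝 z] fun _ => 1 := by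
      filter_upwards [(isOpen_lt continuous_norm continuous_const).mem_nhds hz] with y hy
      refine f.one_of_mem_closedBall ?_
      rw [mem_closedBall_zero_iff, norm_smul, norm_inv, Real.norm_of_nonneg hR.le]
      exact (inv_mul_le_one₀ hR).2 (le_of_lt hy)
    rw [gradient, h.fderiv_eq]
    simp

/-- The difference `w` of two solutions is tested against `χ² w` with a cutoff `χ` at scale `R`. By
Caccioppoli's inequality the energy of `w` is at most a multiple of the integral of `w² |∇ χ|²`,
which is `O(R⁻²)` since `w = O(|z|⁻¹)`. -/
theorem IsNeumannSolution.eqOn {Ω : Set ℂ} (hΩ : IsBounded Ω)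
    (hconn : IsPreconnected (exteriorOf Ω)) {h u₁ u₂ : ℂ → ℝ}
    (h₁ : IsNeumannSolution Ω h u₁) (h₂ : IsNeumannSolution Ω h u₂) :
    EqOn u₁ u₂ (exteriorOf Ω) := by
  set D := exteriorOf Ω with hDdef
  have hD : IsOpen D := isOpen_exteriorOf Ω
  set w : ℂ → ℝ := fun z => u₁ z - u₂ z with hw
  have hs₁ := h₁.harmonic.contDiffOn_infty
  have hs₂ := h₂.harmonic.contDiffOn_infty
  have hws : ContDiffOn ℝ ∞ w D := hs₁.sub hs₂
  have hdiff : ∀ {f : ℂ → ℝ}, ContDiffOn ℝ ∞ f D → ∀ z ∈ D, DifferentiableAt ℝ f z :=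
    fun hf z hz => (hf.differentiableOn (by simp)).differentiableAt (hD.mem_nhds hz)
  have hgw : ∀ z ∈ D, ∇ w z = ∇ u₁ z - ∇ u₂ z := fun z hz =>
    gradient_sub (hdiff hs₁ z hz) (hdiff hs₂ z hz)
  have hgc : ContinuousOn (∇ w) D := continuousOn_gradient hD (hws.of_le (by simp))
  have hw2 : ∀ R : ℝ, IntegrableOn (fun z => w z ^ 2) (D ∩ Metric.ball 0 R) := by
    intro R
    refine Integrable.mono' (((h₁.sq_integrable R).add (h₂.sq_integrable R)).const_mul 2)
      (((hws.continuousOn.pow 2).mono inter_subset_left).aestronglyMeasurable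
        (hD.measurableSet.inter measurableSet_ball)) (Eventually.of_forall fun z => ?_)
    rw [Real.norm_of_nonneg (sq_nonneg _)]
    simp only [Pi.add_apply, hw]
    nlinarith [sq_nonneg (u₁ z + u₂ z)]
  have hgw2 : ∀ R : ℝ, IntegrableOn (fun z => ‖∇ w z‖ ^ 2) (D ∩ Metric.ball 0 R) := by
    intro R
    refine Integrable.mono' (((h₁.grad_sq_integrable R).add (h₂.grad_sq_integrable R)).const_mul 2)
      (((hgc.norm.pow 2).mono inter_subset_left).aestronglyMeasurable
        (hD.measurableSet.inter measurableSet_ball))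
      ((ae_restrict_iff' (hD.measurableSet.inter measurableSet_ball)).2
        (Eventually.of_forall fun z hz => ?_))
    rw [Real.norm_of_nonneg (sq_nonneg _), hgw z hz.1]
    have := norm_sub_le (∇ u₁ z) (∇ u₂ z)
    simp only [Pi.add_apply]
    nlinarith [sq_nonneg (‖∇ u₁ z‖ - ‖∇ u₂ z‖), norm_nonneg (∇ u₁ z - ∇ u₂ z)]
  have hweak : ∀ v : ℂ → ℝ, IsExteriorTestFunction Ω v →
      ∫ z in D, inner ℝ (∇ w z) (∇ v z) = 0 := by
    intro v hv
    have := integral_sub (h₁.integrableOn_inner_gradient hv) (h₂.integrableOn_inner_gradient hv)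
    rw [h₁.neumann v hv, h₂.neumann v hv, sub_zero] at this
    rw [← this]
    refine setIntegral_congr_fun hD.measurableSet fun z hz => ?_
    rw [hgw z hz, inner_sub_left]
  obtain ⟨C, R₀, hR₀, hdecay⟩ : ∃ C R₀ : ℝ, 0 < R₀ ∧ ∀ z : ℂ, R₀ ≤ ‖z‖ → |w z| ≤ C / ‖z‖ := by
    obtain ⟨C, hC⟩ := (h₁.decay.sub h₂.decay).bound
    rw [hasBasis_cobounded_norm.eventually_iff] at hC
    obtain ⟨R, -, hR⟩ := hC
    refine ⟨C, max R 1, by positivity, fun z hz => ?_⟩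
    have := @hR z (le_trans (le_max_left _ _) hz)
    rwa [sub_sub_sub_cancel_right, norm_inv, norm_norm, Real.norm_eq_abs, ← div_eq_mul_inv] at this
  obtain ⟨L, hL0, hL⟩ := exists_smooth_cutoff
  have henergy : ∀ R₁ R : ℝ, R₁ ≤ R → R₀ ≤ R →
      ∫ z in D, (Metric.ball 0 R₁).indicator (fun z => ‖∇ w z‖ ^ 2) z
        ≤ 36 * Real.pi * (C * L) ^ 2 / R ^ 2 := by
    intro R₁ R hR₁ hRR
    have hR : 0 < R := hR₀.trans_le hRR
    obtain ⟨χ, hχs, hχ01, hχ1, hχ0, hχg, hχg0⟩ := hL R hR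
    set v : ℂ → ℝ := fun z => χ z * χ z * w z with hv
    have hχd : ∀ z, DifferentiableAt ℝ χ z := fun z => hχs.differentiable (by simp) z
    have hgv : ∀ z ∈ D, ∇ v z = (χ z * χ z) • ∇ w z + (2 * χ z * w z) • ∇ χ z := by
      intro z hz
      rw [hv, gradient_mul (f := fun z => χ z * χ z) ((hχd z).mul (hχd z)) (hdiff hws z hz),
        gradient_mul (hχd z) (hχd z), ← add_smul, smul_smul]
      congr 2
      ring
    have hvs : ContDiffOn ℝ ∞ v D := (hχs.mul hχs).contDiffOn.mul hws
    have hvsupp : ∀ z ∈ exteriorOf Ω, 2 * R ≤ ‖z‖ → v z = 0 := fun z _ hz => by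
      simp [hv, hχ0 z hz]
    have hInd : ∀ {g : ℂ → ℝ}, IntegrableOn g (D ∩ Metric.ball 0 (3 * R)) →
        IntegrableOn ((Metric.ball 0 (3 * R)).indicator g) D := by
      intro g hg
      rw [inter_comm, IntegrableOn, ← Measure.restrict_restrict measurableSet_ball] at hg
      exact (integrable_indicator_iff measurableSet_ball).2 hg
    have hout : ∀ z : ℂ, z ∉ Metric.ball (0 : ℂ) (3 * R) → 2 * R < ‖z‖ := by
      intro z hz
      rw [mem_ball_zero_iff, not_lt] at hz
      linarith
    have htest : IsExteriorTestFunction Ω v := by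
      refine ⟨hvs, ⟨2 * R, hvsupp⟩, ?_, ?_⟩
      · refine Integrable.mono' (hInd (hw2 (3 * R)))
          ((hvs.continuousOn.pow 2).aestronglyMeasurable hD.measurableSet)
          ((ae_restrict_iff' hD.measurableSet).2 (Eventually.of_forall fun z hz => ?_))
        by_cases hzb : z ∈ Metric.ball (0 : ℂ) (3 * R)
        · rw [indicator_of_mem hzb, Real.norm_of_nonneg (sq_nonneg _), hv]
          simp only [mul_pow]
          refine mul_le_of_le_one_left (sq_nonneg _) ?_
          exact mul_le_one₀ (pow_le_one₀ (hχ01 z).1 (hχ01 z).2) (sq_nonneg _)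
            (pow_le_one₀ (hχ01 z).1 (hχ01 z).2)
        · rw [indicator_of_notMem hzb, hvsupp z hz (hout z hzb).le]
          simp
      · refine Integrable.mono' (hInd (((hgw2 (3 * R)).const_mul 2).add
          ((hw2 (3 * R)).const_mul (8 * (L / R) ^ 2))))
          (((continuousOn_gradient hD (hvs.of_le (by simp))).norm.pow 2).aestronglyMeasurable
            hD.measurableSet)
          ((ae_restrict_iff' hD.measurableSet).2 (Eventually.of_forall fun z hz => ?_))
        by_cases hzb : z ∈ Metric.ball (0 : ℂ) (3 * R)
        · rw [indicator_of_mem hzb, Real.norm_of_nonneg (sq_nonneg _), hgv z hz]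
          have n1 : ‖(χ z * χ z) • ∇ w z‖ ≤ ‖∇ w z‖ := by
            rw [norm_smul, Real.norm_of_nonneg (mul_self_nonneg _)]
            exact mul_le_of_le_one_left (norm_nonneg _)
              (mul_le_one₀ (hχ01 z).2 (hχ01 z).1 (hχ01 z).2)
          have n2 : ‖(2 * χ z * w z) • ∇ χ z‖ ≤ 2 * |w z| * (L / R) := by
            rw [norm_smul, Real.norm_eq_abs, abs_mul, abs_mul, abs_two, abs_of_nonneg (hχ01 z).1]
            have := hχg z
            have := (hχ01 z).2
            gcongr
            nlinarith
          have n3 := (norm_add_le ((χ z * χ z) • ∇ w z) ((2 * χ z * w z) • ∇ χ z)).trans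
            (add_le_add n1 n2)
          have n4 := pow_le_pow_left₀ (norm_nonneg _) n3 2
          refine n4.trans ?_
          simp only [Pi.add_apply]
          have n5 := sq_abs (w z)
          have n6 : (‖∇ w z‖ + 2 * |w z| * (L / R)) ^ 2
              ≤ 2 * ‖∇ w z‖ ^ 2 + 2 * (2 * |w z| * (L / R)) ^ 2 := by
            nlinarith [sq_nonneg (‖∇ w z‖ - 2 * |w z| * (L / R))]
          refine n6.trans (le_of_eq ?_)
          rw [mul_pow, mul_pow, n5]
          ring
        · rw [indicator_of_notMem hzb,
            IsExteriorTestFunction.gradient_eq_zero hvsupp hz (hout z hzb)]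
          simp
    have hint : IntegrableOn (fun z => inner ℝ (∇ w z) (∇ v z)) D :=
      _root_.integrableOn_inner_gradient (hws.of_le (by simp)) hgw2 htest
    set K : ℝ := 4 * (C * L) ^ 2 / R ^ 4 with hK
    have hconst : IntegrableOn ((Metric.ball (0 : ℂ) (3 * R)).indicator fun _ => K) D := by
      refine hInd (integrableOn_const ?_)
      exact ((measure_mono inter_subset_right).trans_lt measure_ball_lt_top).ne
    -- The cross term is absorbed by Young's inequality; the remainder `w² |∇ χ|² ≤ (C L / R²)²`
    -- lives on the annulus `R ≤ |z| ≤ 2 R`.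
    have hpt : ∀ z ∈ D, (Metric.ball (0 : ℂ) R₁).indicator (fun z => ‖∇ w z‖ ^ 2) z
        ≤ 2 * inner ℝ (∇ w z) (∇ v z) + (Metric.ball (0 : ℂ) (3 * R)).indicator (fun _ => K) z := by
      intro z hz
      have hKnn : 0 ≤ (Metric.ball (0 : ℂ) (3 * R)).indicator (fun _ => K) z :=
        indicator_nonneg (fun _ _ => by positivity) _
      have hin : inner ℝ (∇ w z) (∇ v z)
          = (χ z * χ z) * ‖∇ w z‖ ^ 2 + (2 * χ z * w z) * inner ℝ (∇ w z) (∇ χ z) := by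
        rw [hgv z hz, inner_add_right, inner_smul_right, inner_smul_right,
          real_inner_self_eq_norm_sq]
      rcases lt_or_ge ‖z‖ R with hlt | hge
      · rw [hin, hχ1 z hlt.le, hχg0 z hlt, inner_zero_right]
        by_cases hb : z ∈ Metric.ball (0 : ℂ) R₁
        · rw [indicator_of_mem hb]
          nlinarith [sq_nonneg ‖∇ w z‖]
        · rw [indicator_of_notMem hb]
          nlinarith [sq_nonneg ‖∇ w z‖]
      · rw [indicator_of_notMem (by rw [mem_ball_zero_iff]; linarith)]
        by_cases hb : z ∈ Metric.ball (0 : ℂ) (3 * R)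
        · rw [indicator_of_mem hb, hin]
          have e1 : |w z| ≤ C / R := by
            have := hdecay z (hRR.trans hge)
            have hC : 0 ≤ C := by
              have h5 := (abs_nonneg _).trans this
              rcases (div_nonneg_iff.1 h5) with h6 | h6
              · exact h6.1
              · linarith [hR.trans_le hge]
            exact this.trans (div_le_div_of_nonneg_left hC hR hge)
          have e2 := abs_real_inner_le_norm (∇ w z) (∇ χ z)
          have e3 := hχg z
          have e4 : |w z| * ‖∇ χ z‖ ≤ C * L / R ^ 2 := by
            calc |w z| * ‖∇ χ z‖ ≤ (C / R) * (L / R) := by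
                  refine mul_le_mul e1 e3 (norm_nonneg _) ((abs_nonneg _).trans e1)
              _ = _ := by ring
          have e5 : |w z * inner ℝ (∇ w z) (∇ χ z)| ≤ ‖∇ w z‖ * (C * L / R ^ 2) := by
            rw [abs_mul]
            calc |w z| * |inner ℝ (∇ w z) (∇ χ z)| ≤ |w z| * (‖∇ w z‖ * ‖∇ χ z‖) := by gcongr
              _ = ‖∇ w z‖ * (|w z| * ‖∇ χ z‖) := by ring
              _ ≤ _ := by gcongr
          have e6 := (abs_le.1 e5).1
          have e7 : K = 4 * (C * L / R ^ 2) ^ 2 := by rw [hK]; ring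
          have e8 := mul_le_mul_of_nonneg_left e6 (hχ01 z).1
          rw [e7]
          have e9 := sq_nonneg (χ z * ‖∇ w z‖ - C * L / R ^ 2)
          have e10 : 0 ≤ (C * L / R ^ 2) ^ 2 := sq_nonneg _
          nlinarith
        · rw [IsExteriorTestFunction.gradient_eq_zero hvsupp hz (hout z hb), inner_zero_right]
          linarith
    calc ∫ z in D, (Metric.ball 0 R₁).indicator (fun z => ‖∇ w z‖ ^ 2) z
        ≤ ∫ z in D, (2 * inner ℝ (∇ w z) (∇ v z)
            + (Metric.ball (0 : ℂ) (3 * R)).indicator (fun _ => K) z) := by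
          refine integral_mono_of_nonneg
            (Eventually.of_forall fun z => indicator_nonneg (fun _ _ => sq_nonneg _) _)
            ((hint.const_mul 2).add hconst)
            ((ae_restrict_iff' hD.measurableSet).2 (Eventually.of_forall hpt))
      _ = ∫ z in D, (Metric.ball (0 : ℂ) (3 * R)).indicator (fun _ => K) z := by
          rw [integral_add (hint.const_mul 2) hconst, integral_const_mul, hweak v htest]
          simp
      _ ≤ volume.real (Metric.ball (0 : ℂ) (3 * R)) * K := by
          rw [setIntegral_indicator measurableSet_ball, setIntegral_const, smul_eq_mul]
          gcongr
          · exact measure_ball_lt_top.ne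
          · exact inter_subset_right
      _ = _ := by
          rw [Measure.real, Complex.volume_ball, ENNReal.toReal_mul, ENNReal.toReal_pow,
            ENNReal.toReal_ofReal (by positivity), hK]
          simp
          field_simp
          ring
  have hzero : ∀ R₁ : ℝ, ∫ z in D, (Metric.ball 0 R₁).indicator (fun z => ‖∇ w z‖ ^ 2) z = 0 := by
    intro R₁
    refine le_antisymm ?_ (integral_nonneg fun z => indicator_nonneg (fun _ _ => sq_nonneg _) _)
    have hlim : Tendsto (fun R : ℝ => 36 * Real.pi * (C * L) ^ 2 / R ^ 2) atTop (𝓝 0) :=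
      tendsto_const_nhds.div_atTop (tendsto_pow_atTop two_ne_zero)
    refine ge_of_tendsto hlim ?_
    filter_upwards [eventually_ge_atTop R₁, eventually_ge_atTop R₀] with R k1 k2
      using henergy R₁ R k1 k2
  have hgrad0 : ∀ z ∈ D, ∇ w z = 0 := by
    intro z hz
    have hopen : IsOpen (D ∩ Metric.ball 0 (‖z‖ + 1)) := hD.inter Metric.isOpen_ball
    have h5 := hzero (‖z‖ + 1)
    rw [setIntegral_indicator measurableSet_ball,
      setIntegral_eq_zero_iff_of_nonneg_ae (Eventually.of_forall fun _ => sq_nonneg _)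
        (hgw2 _)] at h5
    have h6 := Measure.eqOn_open_of_ae_eq h5 hopen
      ((hgc.norm.pow 2).mono inter_subset_left) continuousOn_const
    have h7 := h6 ⟨hz, by simp⟩
    simpa using h7
  have hconstw : ∀ x ∈ D, ∀ y ∈ D, w x = w y := fun x hx y hy =>
    hD.is_const_of_fderiv_eq_zero hconn (fun z hz => (hdiff hws z hz).differentiableWithinAt)
      (fun z hz => by
        have := hgrad0 z hz
        rwa [← norm_eq_zero, norm_gradient_eq, norm_eq_zero] at this) hx hy
  intro z hz
  have hwz : Tendsto w (cobounded ℂ) (𝓝 0) := by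
    refine squeeze_zero_norm' (a := fun z => C / ‖z‖) ?_
      (tendsto_const_nhds.div_atTop tendsto_norm_cobounded_atTop)
    filter_upwards [tendsto_norm_cobounded_atTop.eventually_ge_atTop R₀] with y hy
    exact hdecay y hy
  have hwc : Tendsto w (cobounded ℂ) (𝓝 (w z)) := by
    refine tendsto_const_nhds.congr' ?_
    filter_upwards [IsExteriorConformalMap.eventually_mem_exteriorOf hΩ] with y hy
    exact hconstw z hz y hy
  exact sub_eq_zero.1 (tendsto_nhds_unique hwc hwz)

/-! ### Integration by parts in the strip -/

/-- The half-strip `ε < Re w`, `-π < Im w ≤ π`. For `ε = 0` the exponential maps it bijectively onto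
the exterior of the unit disk. -/
def halfStrip (ε : ℝ) : Set ℂ := Ioi ε ×ℂ Ioc (-Real.pi) Real.pi

/-- The open right half plane. -/
def rightHalfPlane : Set ℂ := {w | 0 < w.re}

theorem isOpen_rightHalfPlane : IsOpen rightHalfPlane :=
  isOpen_lt continuous_const Complex.continuous_re

theorem measurableSet_halfStrip (ε : ℝ) : MeasurableSet (halfStrip ε) :=
  (measurableSet_Ioi.preimage Complex.measurable_re).inter
    (measurableSet_Ioc.preimage Complex.measurable_im)

theorem halfStrip_subset {ε : ℝ} (hε : 0 ≤ ε) : halfStrip ε ⊆ rightHalfPlane :=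
  fun _ hw => hε.trans_lt hw.1

theorem halfStrip_anti {ε ε' : ℝ} (h : ε ≤ ε') : halfStrip ε' ⊆ halfStrip ε :=
  fun _ hw => ⟨h.trans_lt hw.1, hw.2⟩

theorem fderiv_one_eq_re_gradient (W : ℂ → ℝ) (w : ℂ) : fderiv ℝ W w 1 = (∇ W w).re := by
  rw [← inner_gradient_left, Complex.inner]
  simp

theorem fderiv_I_eq_im_gradient (W : ℂ → ℝ) (w : ℂ) : fderiv ℝ W w Complex.I = (∇ W w).im := by
  rw [← inner_gradient_left, Complex.inner]
  simp

/-- For `P` holomorphic, `P ∇ W` (a product of complex numbers) is a complex divergence, so that its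
integral over the half-strip reduces to the left edge: the horizontal edges cancel by periodicity,
and `W` vanishes far to the right. -/
theorem setIntegral_halfStrip_mul_gradient {W : ℂ → ℝ} {P : ℂ → ℂ} {ε L : ℝ} (hε : 0 < ε)
    (hεL : ε ≤ L) (hW : ContDiffOn ℝ 1 W rightHalfPlane) (hP : Differentiable ℂ P)
    (hWper : ∀ w ∈ rightHalfPlane, W (w + 2 * Real.pi * Complex.I) = W w)
    (hPper : ∀ w, P (w + 2 * Real.pi * Complex.I) = P w)
    (hL : ∀ w ∈ rightHalfPlane, L ≤ w.re → W w = 0) :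
    ∫ w in halfStrip ε, P w * ∇ W w
      = -∫ y in (-Real.pi)..Real.pi, W (ε + y * Complex.I) * P (ε + y * Complex.I) := by
  have hπ : -Real.pi ≤ Real.pi := by linarith [Real.pi_pos]
  set f : ℂ → ℂ := fun w => W w * P w with hf
  set f' : ℂ → ℂ →L[ℝ] ℂ := fun w =>
    (W w : ℂ) • ((fderiv ℂ P w).restrictScalars ℝ) + P w • (Complex.ofRealCLM.comp (fderiv ℝ W w))
    with hf'
  have hH := isOpen_rightHalfPlane
  have hWd : ∀ w ∈ rightHalfPlane, DifferentiableAt ℝ W w := fun w hw =>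
    (hW.differentiableOn (by simp)).differentiableAt (hH.mem_nhds hw)
  have hfd : ∀ w ∈ rightHalfPlane, HasFDerivAt f (f' w) w := fun w hw =>
    (Complex.ofRealCLM.hasFDerivAt.comp w (hWd w hw).hasFDerivAt).mul
      ((hP w).hasFDerivAt.restrictScalars ℝ)
  -- The integrand of the Green formula on a rectangle; the derivatives of `P` cancel by the
  -- Cauchy-Riemann equations.
  have hid : ∀ w, Complex.I • f' w 1 - f' w Complex.I = Complex.I * (P w * ∇ W w) := by
    intro w
    have h1 : fderiv ℂ P w Complex.I = Complex.I * fderiv ℂ P w 1 := by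
      rw [← smul_eq_mul, ← map_smul]
      simp
    conv_rhs => rw [← Complex.re_add_im (∇ W w)]
    simp only [hf', add_apply, smul_apply, ContinuousLinearMap.coe_restrictScalars',
      ContinuousLinearMap.comp_apply, fderiv_one_eq_re_gradient, fderiv_I_eq_im_gradient,
      Complex.ofRealCLM_apply, smul_eq_mul, h1]
    linear_combination (-(P w) * ((∇ W w).im : ℂ)) * Complex.I_sq
  have hgc : ContinuousOn (fun w => P w * ∇ W w) rightHalfPlane :=
    hP.continuous.continuousOn.mul (continuousOn_gradient hH hW)
  have hrect : Icc ε L ×ℂ Icc (-Real.pi) Real.pi ⊆ rightHalfPlane := fun w hw =>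
    hε.trans_le hw.1.1
  have hcomp : IsCompact (Icc ε L ×ℂ Icc (-Real.pi) Real.pi) := isCompact_Icc.reProdIm isCompact_Icc
  have key := Complex.integral_boundary_rect_of_hasFDerivAt_real_off_countable f f'
    (ε - Real.pi * Complex.I) (L + Real.pi * Complex.I) ∅ countable_empty
  simp only [Complex.sub_re, Complex.add_re, Complex.sub_im, Complex.add_im, Complex.ofReal_re,
    Complex.ofReal_im, Complex.re_ofReal_mul, Complex.im_ofReal_mul, Complex.I_re, Complex.I_im,
    mul_zero, mul_one, sub_zero, add_zero, zero_sub, zero_add, uIcc_of_le hεL, uIcc_of_le hπ,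
    min_eq_left hεL, max_eq_right hεL, min_eq_left hπ, max_eq_right hπ, hid] at key
  have hint : IntegrableOn (fun w => P w * ∇ W w) (Icc ε L ×ℂ Icc (-Real.pi) Real.pi) :=
    (hgc.mono hrect).integrableOn_compact hcomp
  specialize key (fun w hw => (hfd w (hrect hw)).continuousAt.continuousWithinAt)
    (fun w hw => hfd w (hε.trans hw.1.1.1)) (hint.const_mul _)
  have hbt : ∀ x ∈ uIcc ε L, f (x + (-Real.pi : ℝ) * Complex.I) = f (x + Real.pi * Complex.I) := by
    intro x hx
    rw [uIcc_of_le hεL] at hx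
    have hmem : ((x : ℂ) + (-Real.pi : ℝ) * Complex.I) ∈ rightHalfPlane := by
      simpa [rightHalfPlane] using hε.trans_le hx.1
    have heq : (x : ℂ) + Real.pi * Complex.I
        = (x + (-Real.pi : ℝ) * Complex.I) + 2 * Real.pi * Complex.I := by push_cast; ring
    simp only [hf]
    rw [heq, hWper _ hmem, hPper]
  have hright : ∀ y : ℝ, f (L + y * Complex.I) = 0 := by
    intro y
    simp only [hf]
    rw [hL _ (by simpa [rightHalfPlane] using hε.trans_le hεL) (by simp)]
    simp
  rw [intervalIntegral.integral_congr hbt, sub_self, zero_add] at key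
  simp only [hright, intervalIntegral.integral_zero, smul_eq_mul,
    intervalIntegral.integral_const_mul] at key
  rw [← mul_sub, zero_sub] at key
  have key2 := mul_left_cancel₀ Complex.I_ne_zero key
  rw [← key2.symm, intervalIntegral.integral_of_le hεL]
  simp only [intervalIntegral.integral_of_le hπ]
  have hsub : Ioc ε L ×ℂ Ioc (-Real.pi) Real.pi ⊆ Icc ε L ×ℂ Icc (-Real.pi) Real.pi :=
    fun w hw => ⟨Ioc_subset_Icc_self hw.1, Ioc_subset_Icc_self hw.2⟩
  have hms : MeasurableSet (Ioc ε L ×ℂ Ioc (-Real.pi) Real.pi) :=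
    (measurableSet_Ioc.preimage Complex.measurable_re).inter
      (measurableSet_Ioc.preimage Complex.measurable_im)
  have hcut : ∫ w in halfStrip ε, P w * ∇ W w
      = ∫ w in Ioc ε L ×ℂ Ioc (-Real.pi) Real.pi, P w * ∇ W w := by
    refine setIntegral_eq_of_subset_of_forall_sdiff_eq_zero (measurableSet_halfStrip ε)
      (fun w hw => ⟨hw.1.1, hw.2⟩) fun w hw => ?_
    have hwL : L < w.re := by
      by_contra! h
      exact hw.2 ⟨⟨hw.1.1, h⟩, hw.1.2⟩
    have h0 : W =ᶠ[𝓝 w] fun _ => 0 := by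
      filter_upwards [hH.mem_nhds (halfStrip_subset hε.le hw.1),
        (isOpen_lt continuous_const Complex.continuous_re).mem_nhds hwL] with y h1 h2
      exact hL y h1 (le_of_lt h2)
    rw [gradient, h0.fderiv_eq]
    simp
  have hmp := Complex.volume_preserving_equiv_real_prod.symm
  rw [hcut, ← hmp.setIntegral_preimage_emb (MeasurableEquiv.measurableEmbedding _)]
  have hint2 := (hmp.integrableOn_comp_preimage (MeasurableEquiv.measurableEmbedding _)).2
    (hint.mono_set hsub)
  rw [show (Complex.measurableEquivRealProd.symm ⁻¹' (Ioc ε L ×ℂ Ioc (-Real.pi) Real.pi))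
    = Ioc ε L ×ˢ Ioc (-Real.pi) Real.pi from rfl] at hint2 ⊢
  refine (setIntegral_prod _ hint2).trans ?_
  refine setIntegral_congr_fun measurableSet_Ioc fun x _ => ?_
  refine setIntegral_congr_fun measurableSet_Ioc fun y _ => ?_
  exact congrArg (fun w => P w * ∇ W w) (Complex.mk_eq_add_mul_I x y)

theorem volume_halfStrip_inter_lt_top (L : ℝ) :
    volume (halfStrip 0 ∩ {w : ℂ | w.re ≤ L}) < ⊤ := by
  refine (measure_mono ?_).trans_lt
    ((isCompact_Icc (a := (0 : ℝ)) (b := L)).reProdIm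
      (isCompact_Icc (a := -Real.pi) (b := Real.pi))).measure_lt_top
  exact fun w hw => ⟨⟨le_of_lt hw.1.1, hw.2⟩, Ioc_subset_Icc_self hw.1.2⟩

/-- The weak Neumann condition in the half-strip, for the function `Re (a e ^ w + conj a e ^ (-w))`.
The boundary term on `Re w = ε` is `1 - e ^ (-2 ε)` times the one for the field `a e ^ w`, and the
latter is bounded uniformly in `ε` since `W` has finite energy. -/
theorem setIntegral_halfStrip_re_eq_zero {W : ℂ → ℝ} {L : ℝ}
    (hW : ContDiffOn ℝ 1 W rightHalfPlane)
    (hWper : ∀ w ∈ rightHalfPlane, W (w + 2 * Real.pi * Complex.I) = W w)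
    (hL : ∀ w ∈ rightHalfPlane, L ≤ w.re → W w = 0)
    (hW2 : IntegrableOn (fun w => ‖∇ W w‖ ^ 2) (halfStrip 0)) (a : ℂ) :
    ∫ w in halfStrip 0,
      (((a * Complex.exp w - (starRingEnd ℂ) a * Complex.exp (-w)) * ∇ W w).re) = 0 := by
  have hH := isOpen_rightHalfPlane
  have hgc := continuousOn_gradient hH hW
  have hms := measurableSet_halfStrip 0
  have hLset : MeasurableSet {w : ℂ | w.re ≤ L} :=
    measurableSet_le Complex.measurable_re measurable_const
  have hg0 : ∀ w ∈ rightHalfPlane, L < w.re → ∇ W w = 0 := by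
    intro w hw hwL
    have h0 : W =ᶠ[𝓝 w] fun _ => 0 := by
      filter_upwards [hH.mem_nhds hw,
        (isOpen_lt continuous_const Complex.continuous_re).mem_nhds hwL] with y h1 h2
      exact hL y h1 (le_of_lt h2)
    rw [gradient, h0.fderiv_eq]
    simp
  have hgrad : IntegrableOn (fun w => ‖∇ W w‖) (halfStrip 0) := by
    have h1 : IntegrableOn ({w : ℂ | w.re ≤ L}.indicator fun _ => (1 : ℝ)) (halfStrip 0) := by
      rw [IntegrableOn, integrable_indicator_iff hLset, IntegrableOn,
        Measure.restrict_restrict hLset, inter_comm]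
      exact integrableOn_const (volume_halfStrip_inter_lt_top L).ne
    refine Integrable.mono' (h1.add hW2)
      ((hgc.norm.mono (halfStrip_subset le_rfl)).aestronglyMeasurable hms)
      ((ae_restrict_iff' hms).2 (Eventually.of_forall fun w hw => ?_))
    rw [norm_norm]
    simp only [Pi.add_apply]
    by_cases hwL : w.re ≤ L
    · rw [indicator_of_mem (by exact hwL)]
      nlinarith [sq_nonneg (‖∇ W w‖ - 1)]
    · rw [hg0 w (halfStrip_subset le_rfl hw) (not_le.1 hwL)]
      simp [hwL]
  -- `∇ W` vanishes for `Re w > L`, so any continuous `P` is bounded where it matters.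
  have hmul : ∀ P : ℂ → ℂ, Continuous P →
      IntegrableOn (fun w => P w * ∇ W w) (halfStrip 0) := by
    intro P hP
    obtain ⟨B, hB⟩ := ((isCompact_Icc (a := (0 : ℝ)) (b := L)).reProdIm
      (isCompact_Icc (a := -Real.pi) (b := Real.pi))).exists_bound_of_continuousOn hP.continuousOn
    refine Integrable.mono' (hgrad.const_mul B)
      (((hP.continuousOn.mul hgc).mono (halfStrip_subset le_rfl)).aestronglyMeasurable hms)
      ((ae_restrict_iff' hms).2 (Eventually.of_forall fun w hw => ?_))
    by_cases hwL : w.re ≤ L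
    · rw [norm_mul]
      gcongr
      exact hB w ⟨⟨le_of_lt hw.1, hwL⟩, Ioc_subset_Icc_self hw.2⟩
    · rw [hg0 w (halfStrip_subset le_rfl hw) (not_le.1 hwL)]
      simp
  set P : ℂ → ℂ := fun w => a * Complex.exp w - (starRingEnd ℂ) a * Complex.exp (-w) with hP
  set Q : ℂ → ℂ := fun w => a * Complex.exp w with hQ
  have hPd : Differentiable ℂ P := by fun_prop
  have hQd : Differentiable ℂ Q := by fun_prop
  have hexp : ∀ w : ℂ, Complex.exp (w + 2 * Real.pi * Complex.I) = Complex.exp w :=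
    Complex.exp_periodic
  have hexp' : ∀ w : ℂ, Complex.exp (-(w + 2 * Real.pi * Complex.I)) = Complex.exp (-w) :=
    fun w => by rw [Complex.exp_neg, hexp, Complex.exp_neg]
  have hQper : ∀ w, Q (w + 2 * Real.pi * Complex.I) = Q w := fun w => by simp only [hQ, hexp]
  have hPper : ∀ w, P (w + 2 * Real.pi * Complex.I) = P w := fun w => by
    simp only [hP, hexp, hexp']
  have hre : ∀ (ε y : ℝ), (P (ε + y * Complex.I)).re
      = (1 - Real.exp (-(2 * ε))) * (Q (ε + y * Complex.I)).re := by
    intro ε y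
    have h1 : (starRingEnd ℂ) a * Complex.exp (-(ε + y * Complex.I))
        = ((Real.exp (-(2 * ε)) : ℝ) : ℂ) * (starRingEnd ℂ) (Q (ε + y * Complex.I)) := by
      simp only [hQ, map_mul, ← Complex.exp_conj, map_add, Complex.conj_ofReal, Complex.conj_I]
      rw [mul_left_comm, Complex.ofReal_exp, ← Complex.exp_add]
      congr 2
      push_cast
      ring
    simp only [hP]
    rw [h1, Complex.sub_re, Complex.re_ofReal_mul, Complex.conj_re]
    simp only [hQ]
    ring
  -- By `hre`, the boundary terms at `Re w = ε` of the fields `P` and `Q` are proportional.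
  have hbd : ∀ ε : ℝ, 0 < ε → ε ≤ L → |(∫ w in halfStrip ε, P w * ∇ W w).re|
      ≤ (1 - Real.exp (-(2 * ε))) * ∫ w in halfStrip 0, ‖Q w * ∇ W w‖ := by
    intro ε hε hεL
    have hWc : ∀ R : ℂ → ℂ, Continuous R → IntervalIntegrable
        (fun y : ℝ => (W (ε + y * Complex.I) : ℂ) * R (ε + y * Complex.I)) volume
        (-Real.pi) Real.pi := by
      intro R hR
      refine Continuous.intervalIntegrable ?_ _ _
      have : Continuous fun y : ℝ => W (ε + y * Complex.I) :=
        hW.continuousOn.comp_continuous (by fun_prop) fun y => by simpa [rightHalfPlane] using hε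
      exact (Complex.continuous_ofReal.comp this).mul (hR.comp (by fun_prop))
    have hI : ∀ R : ℂ → ℂ, Differentiable ℂ R → (∀ w, R (w + 2 * Real.pi * Complex.I) = R w) →
        (∫ w in halfStrip ε, R w * ∇ W w).re
          = -∫ y in (-Real.pi)..Real.pi, W (ε + y * Complex.I) * (R (ε + y * Complex.I)).re := by
      intro R hR hper
      rw [setIntegral_halfStrip_mul_gradient hε hεL hW hR hWper hper hL, Complex.neg_re]
      have := Complex.reCLM.intervalIntegral_comp_comm (hWc R hR.continuous)
      simp only [Complex.reCLM_apply, Complex.re_ofReal_mul] at this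
      rw [this]
    rw [hI P hPd hPper]
    have h2 : ∫ y in (-Real.pi)..Real.pi, W (ε + y * Complex.I) * (P (ε + y * Complex.I)).re
        = (1 - Real.exp (-(2 * ε)))
          * ∫ y in (-Real.pi)..Real.pi, W (ε + y * Complex.I) * (Q (ε + y * Complex.I)).re := by
      rw [← intervalIntegral.integral_const_mul]
      refine intervalIntegral.integral_congr fun y _ => ?_
      simp only [hre]
      ring
    have h3 : 0 ≤ 1 - Real.exp (-(2 * ε)) := by
      have : Real.exp (-(2 * ε)) ≤ 1 := Real.exp_le_one_iff.2 (by linarith)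
      linarith
    rw [h2, ← mul_neg, ← hI Q hQd hQper, abs_mul, abs_of_nonneg h3]
    refine mul_le_mul_of_nonneg_left ?_ h3
    refine (Complex.abs_re_le_norm _).trans ((norm_integral_le_integral_norm _).trans ?_)
    exact setIntegral_mono_set (hmul Q hQd.continuous).norm
      (Eventually.of_forall fun _ => norm_nonneg _) (halfStrip_anti hε.le).eventuallyLE
  have hre0 : ∫ w in halfStrip 0, (P w * ∇ W w).re = (∫ w in halfStrip 0, P w * ∇ W w).re := by
    have := Complex.reCLM.integral_comp_comm (hmul P hPd.continuous)
    simpa using this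
  change ∫ w in halfStrip 0, (P w * ∇ W w).re = 0
  rw [hre0]
  by_cases hL0 : L ≤ 0
  · rw [setIntegral_congr_fun (g := fun _ => (0 : ℂ)) hms fun w hw => by
      simp [hg0 w (halfStrip_subset le_rfl hw) (hL0.trans_lt hw.1)]]
    simp
  push Not at hL0
  set δ : ℕ → ℝ := fun n => 1 / ((n : ℝ) + 1) with hδ
  have hδ0 : Tendsto δ atTop (𝓝 0) := tendsto_one_div_add_atTop_nhds_zero_nat
  have hunion : ⋃ n, halfStrip (δ n) = halfStrip 0 := by
    refine subset_antisymm (iUnion_subset fun n => halfStrip_anti (by positivity)) fun w hw => ?_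
    obtain ⟨n, hn⟩ := exists_nat_one_div_lt (show 0 < w.re from hw.1)
    exact mem_iUnion.2 ⟨n, hn, hw.2⟩
  have hlim := tendsto_setIntegral_of_monotone (μ := volume) (f := fun w => P w * ∇ W w)
    (s := fun n => halfStrip (δ n)) (fun n => measurableSet_halfStrip _)
    (fun m n hmn => halfStrip_anti (by simp only [hδ]; gcongr))
    (by rw [hunion]; exact hmul P hPd.continuous)
  rw [hunion] at hlim
  have hlim2 := (Complex.continuous_re.tendsto _).comp hlim
  refine tendsto_nhds_unique hlim2 ?_
  refine squeeze_zero_norm' (a := fun n =>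
    (1 - Real.exp (-(2 * δ n))) * ∫ w in halfStrip 0, ‖Q w * ∇ W w‖) ?_ ?_
  · filter_upwards [hδ0.eventually (gt_mem_nhds hL0)] with n hn
    exact hbd (δ n) (by positivity) hn.le
  · have h4 : Tendsto (fun n => 1 - Real.exp (-(2 * δ n))) atTop (𝓝 (1 - Real.exp (-(2 * 0)))) :=
      tendsto_const_nhds.sub ((hδ0.const_mul 2).neg.rexp)
    have h5 := h4.mul_const (∫ w in halfStrip 0, ‖Q w * ∇ W w‖)
    simpa using h5

/-! ### Conformal invariance of the Dirichlet integral -/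

theorem gradient_comp_of_hasDerivAt {f : ℂ → ℝ} {T : ℂ → ℂ} {t w : ℂ} (hT : HasDerivAt T t w)
    (hf : DifferentiableAt ℝ f (T w)) :
    ∇ (fun x => f (T x)) w = (starRingEnd ℂ) t * ∇ f (T w) := by
  have h := (hf.hasFDerivAt.comp w (hT.hasFDerivAt.restrictScalars ℝ)).fderiv
  refine ext_inner_right ℝ fun y => ?_
  rw [inner_gradient_left, show (fun x => f (T x)) = f ∘ T from rfl, h]
  have h2 : fderiv ℝ f (T w) (y * t) = inner ℝ (∇ f (T w)) (y * t) := by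
    rw [inner_gradient_left]
  simp only [ContinuousLinearMap.comp_apply]
  refine Eq.trans ?_ (h2.trans ?_)
  · simp
  · simp only [Complex.inner, map_mul, Complex.conj_conj]
    congr 1
    ring

theorem gradient_re_of_hasDerivAt {F : ℂ → ℂ} {t w : ℂ} (hF : HasDerivAt F t w) :
    ∇ (fun x => (F x).re) w = (starRingEnd ℂ) t := by
  refine ext_inner_right ℝ fun y => ?_
  have h := (Complex.reCLM.hasFDerivAt.comp w (hF.hasFDerivAt.restrictScalars ℝ)).fderiv
  rw [inner_gradient_left, show (fun x => (F x).re) = Complex.reCLM ∘ F from rfl, h, Complex.inner]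
  simp

/-- Multiplication by `t` on `ℂ`, as a real linear map, has determinant `|t|²`. -/
theorem abs_det_toSpanSingleton (t : ℂ) :
    |((ContinuousLinearMap.toSpanSingleton ℂ t).restrictScalars ℝ).det| = ‖t‖ ^ 2 := by
  have h : ((((ContinuousLinearMap.toSpanSingleton ℂ t).restrictScalars ℝ : ℂ →L[ℝ] ℂ)) :
      ℂ →ₗ[ℝ] ℂ) = Algebra.lmul ℝ ℂ t := by
    ext
    simp [mul_comm]
  rw [ContinuousLinearMap.det, h, ← Algebra.norm_apply, Algebra.norm_complex_apply,
    Complex.normSq_eq_norm_sq, abs_of_nonneg (sq_nonneg _)]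

theorem exp_mem_exteriorDisk {w : ℂ} (hw : w ∈ rightHalfPlane) : Complex.exp w ∈ exteriorDisk := by
  rw [exteriorDisk, mem_ofPred, Complex.norm_exp]
  exact Real.one_lt_exp_iff.2 hw

/-- The parametrization `w ↦ Φ (e ^ w)` of the exterior domain by the half-strip. -/
noncomputable def stripMap (Φ : ℂ → ℂ) (w : ℂ) : ℂ := Φ (Complex.exp w)

namespace IsExteriorConformalMap

variable {Ω : Set ℂ} {Φ : ℂ → ℂ} {c : ℝ} {μ : ℕ → ℂ}

theorem stripMap_mem (h : IsExteriorConformalMap Ω Φ c μ) {w : ℂ} (hw : w ∈ rightHalfPlane) :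
    stripMap Φ w ∈ exteriorOf Ω :=
  h.bijective.mapsTo (exp_mem_exteriorDisk hw)

theorem hasDerivAt_stripMap (h : IsExteriorConformalMap Ω Φ c μ) {w : ℂ}
    (hw : w ∈ rightHalfPlane) : HasDerivAt (stripMap Φ) (deriv (stripMap Φ) w) w :=
  (DifferentiableAt.comp w (h.holomorphic.differentiableAt
    (isOpen_exteriorDisk.mem_nhds (exp_mem_exteriorDisk hw)))
      Complex.differentiable_exp.differentiableAt).hasDerivAt

theorem image_stripMap (h : IsExteriorConformalMap Ω Φ c μ) :
    stripMap Φ '' halfStrip 0 = exteriorOf Ω := by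
  refine subset_antisymm ?_ fun z hz => ?_
  · rintro _ ⟨w, hw, rfl⟩
    exact h.stripMap_mem (halfStrip_subset le_rfl hw)
  · have hm := h.exteriorInv_mem hz
    have hne : exteriorInv Φ z ≠ 0 := by
      intro h0
      rw [h0] at hm
      simp [exteriorDisk] at hm
      linarith
    refine ⟨Complex.log (exteriorInv Φ z), ⟨?_, ?_, ?_⟩, ?_⟩
    · change 0 < (Complex.log _).re
      rw [Complex.log_re]
      exact Real.log_pos hm
    · exact Complex.neg_pi_lt_log_im _
    · exact Complex.log_im_le_pi _
    · rw [stripMap, Complex.exp_log hne, h.apply_exteriorInv hz]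

theorem isPreconnected_exteriorOf (h : IsExteriorConformalMap Ω Φ c μ) :
    IsPreconnected (exteriorOf Ω) := by
  have hconv : Convex ℝ (halfStrip 0) :=
    ((convex_Ioi (0 : ℝ)).linear_preimage Complex.reLm).inter
      ((convex_Ioc (-Real.pi) Real.pi).linear_preimage Complex.imLm)
  rw [← h.image_stripMap]
  exact hconv.isPreconnected.image _ fun w hw =>
    (h.hasDerivAt_stripMap (halfStrip_subset le_rfl hw)).continuousAt.continuousWithinAt

theorem injOn_stripMap (h : IsExteriorConformalMap Ω Φ c μ) :
    InjOn (stripMap Φ) (halfStrip 0) := by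
  intro w hw w' hw' heq
  have := h.bijective.injOn (exp_mem_exteriorDisk (halfStrip_subset le_rfl hw))
    (exp_mem_exteriorDisk (halfStrip_subset le_rfl hw')) heq
  exact Complex.exp_inj_of_neg_pi_lt_of_le_pi hw.2.1 hw.2.2 hw'.2.1 hw'.2.2 this

theorem contDiffOn_stripMap (h : IsExteriorConformalMap Ω Φ c μ) :
    ContDiffOn ℝ ∞ (stripMap Φ) rightHalfPlane := by
  have hd : DifferentiableOn ℂ (stripMap Φ) rightHalfPlane := fun w hw =>
    (h.hasDerivAt_stripMap hw).differentiableAt.differentiableWithinAt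
  exact (hd.contDiffOn isOpen_rightHalfPlane).restrict_scalars ℝ

theorem integrableOn_image_stripMap (h : IsExteriorConformalMap Ω Φ c μ) {s : Set ℂ}
    (hs : MeasurableSet s) (hsub : s ⊆ halfStrip 0) (g : ℂ → ℝ) :
    IntegrableOn g (stripMap Φ '' s) ↔
      IntegrableOn (fun w => ‖deriv (stripMap Φ) w‖ ^ 2 * g (stripMap Φ w)) s := by
  rw [integrableOn_image_iff_integrableOn_abs_det_fderiv_smul volume hs
    (fun w hw => ((h.hasDerivAt_stripMap
      (halfStrip_subset le_rfl (hsub hw))).hasFDerivAt.restrictScalars ℝ).hasFDerivWithinAt)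
    (h.injOn_stripMap.mono hsub)]
  simp only [abs_det_toSpanSingleton, smul_eq_mul]

theorem setIntegral_exteriorOf (h : IsExteriorConformalMap Ω Φ c μ) (g : ℂ → ℝ) :
    ∫ z in exteriorOf Ω, g z
      = ∫ w in halfStrip 0, ‖deriv (stripMap Φ) w‖ ^ 2 * g (stripMap Φ w) := by
  rw [← h.image_stripMap, integral_image_eq_integral_abs_det_fderiv_smul volume
    (measurableSet_halfStrip 0) (fun w hw => ((h.hasDerivAt_stripMap
      (halfStrip_subset le_rfl hw)).hasFDerivAt.restrictScalars ℝ).hasFDerivWithinAt)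
    h.injOn_stripMap]
  simp only [abs_det_toSpanSingleton, smul_eq_mul]

theorem norm_sq_mul_inner_gradient (h : IsExteriorConformalMap Ω Φ c μ) {u v : ℂ → ℝ} {w : ℂ}
    (hw : w ∈ rightHalfPlane) (hu : DifferentiableAt ℝ u (stripMap Φ w))
    (hv : DifferentiableAt ℝ v (stripMap Φ w)) :
    ‖deriv (stripMap Φ) w‖ ^ 2 * inner ℝ (∇ u (stripMap Φ w)) (∇ v (stripMap Φ w))
      = inner ℝ (∇ (fun x => u (stripMap Φ x)) w) (∇ (fun x => v (stripMap Φ x)) w) := by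
  have hT := h.hasDerivAt_stripMap hw
  rw [gradient_comp_of_hasDerivAt hT hu, gradient_comp_of_hasDerivAt hT hv, Complex.inner,
    Complex.inner, ← Complex.re_ofReal_mul]
  congr 1
  rw [← Complex.normSq_eq_norm_sq, ← Complex.mul_conj, map_mul, Complex.conj_conj]
  ring

theorem norm_sq_mul_norm_gradient_sq (h : IsExteriorConformalMap Ω Φ c μ) {u : ℂ → ℝ} {w : ℂ}
    (hw : w ∈ rightHalfPlane) (hu : DifferentiableAt ℝ u (stripMap Φ w)) :
    ‖deriv (stripMap Φ) w‖ ^ 2 * ‖∇ u (stripMap Φ w)‖ ^ 2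
      = ‖∇ (fun x => u (stripMap Φ x)) w‖ ^ 2 := by
  rw [gradient_comp_of_hasDerivAt (h.hasDerivAt_stripMap hw) hu, norm_mul, mul_pow,
    RCLike.norm_conj]

/-! ### The solution of the Neumann problem -/

/-- The holomorphic function on the exterior domain whose pullback to the exterior disk is
`a (c ζ + μ₀) + conj a c / ζ`. Its real part is the solution with background potential
`Re (a z)`. -/
noncomputable def potential (Φ : ℂ → ℂ) (c : ℝ) (μ : ℕ → ℂ) (a z : ℂ) : ℂ :=
  a * (c * exteriorInv Φ z + μ 0) + (starRingEnd ℂ) a * c * (exteriorInv Φ z)⁻¹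

theorem differentiableOn_potential (h : IsExteriorConformalMap Ω Φ c μ) (a : ℂ) :
    DifferentiableOn ℂ (potential Φ c μ a) (exteriorOf Ω) := by
  have h1 := h.differentiableOn_exteriorInv
  refine (((h1.const_mul (c : ℂ)).add_const _).const_mul a).add
    ((h1.inv fun z hz h0 => ?_).const_mul _)
  have := h.exteriorInv_mem hz
  rw [h0] at this
  simp [exteriorDisk] at this
  linarith

theorem potential_stripMap (h : IsExteriorConformalMap Ω Φ c μ) (a : ℂ) {w : ℂ}
    (hw : w ∈ rightHalfPlane) : potential Φ c μ a (stripMap Φ w)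
      = a * (c * Complex.exp w + μ 0) + (starRingEnd ℂ) a * c * Complex.exp (-w) := by
  rw [potential, stripMap, h.exteriorInv_apply (exp_mem_exteriorDisk hw), Complex.exp_neg]

theorem gradient_potential_stripMap (h : IsExteriorConformalMap Ω Φ c μ) (a : ℂ) {w : ℂ}
    (hw : w ∈ rightHalfPlane) : ∇ (fun x => (potential Φ c μ a (stripMap Φ x)).re) w
      = (starRingEnd ℂ) (a * c * Complex.exp w
          - (starRingEnd ℂ) (a * c) * Complex.exp (-w)) := by
  refine gradient_re_of_hasDerivAt ?_
  have h1 : HasDerivAt (fun w => a * (c * Complex.exp w + μ 0)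
      + (starRingEnd ℂ) a * c * Complex.exp (-w))
      (a * (c * Complex.exp w) + (starRingEnd ℂ) a * c * (Complex.exp (-w) * -1)) w :=
    ((((Complex.hasDerivAt_exp w).const_mul (c : ℂ)).add_const _).const_mul a).add
      (((hasDerivAt_neg w).cexp).const_mul _)
  refine (h1.congr_of_eventuallyEq ?_).congr_deriv ?_
  · filter_upwards [isOpen_rightHalfPlane.mem_nhds hw] with x hx using h.potential_stripMap a hx
  · rw [map_mul, Complex.conj_ofReal]
    ring

theorem differentiableAt_re_potential (h : IsExteriorConformalMap Ω Φ c μ) (a : ℂ) {z : ℂ}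
    (hz : z ∈ exteriorOf Ω) : DifferentiableAt ℝ (fun z => (potential Φ c μ a z).re) z :=
  Complex.reCLM.differentiableAt.comp z
    (((h.differentiableOn_potential a).differentiableAt
      ((isOpen_exteriorOf Ω).mem_nhds hz)).restrictScalars ℝ)

theorem exists_re_lt (h : IsExteriorConformalMap Ω Φ c μ) (R : ℝ) :
    ∃ L, ∀ w ∈ rightHalfPlane, ‖stripMap Φ w‖ < R → w.re < L := by
  obtain ⟨M, hM⟩ := h.exists_norm_le R
  refine ⟨M, fun w hw hwR => ?_⟩
  have h1 := hM _ (exp_mem_exteriorDisk hw) hwR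
  rw [Complex.norm_exp] at h1
  linarith [Real.add_one_le_exp w.re]

theorem integrableOn_potential_sq (h : IsExteriorConformalMap Ω Φ c μ) (a : ℂ) (R : ℝ) :
    IntegrableOn (fun z => (potential Φ c μ a z).re ^ 2) (exteriorOf Ω ∩ Metric.ball 0 R) := by
  obtain ⟨M, hM⟩ := h.exists_norm_le R
  set B : ℝ := ‖a‖ * (c * M + ‖μ 0‖) + ‖a‖ * c with hB
  have hms : MeasurableSet (exteriorOf Ω ∩ Metric.ball 0 R) :=
    (isOpen_exteriorOf Ω).measurableSet.inter measurableSet_ball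
  have hfin : volume (exteriorOf Ω ∩ Metric.ball 0 R) ≠ ⊤ :=
    ((measure_mono inter_subset_right).trans_lt measure_ball_lt_top).ne
  refine Integrable.mono' (integrableOn_const (C := B ^ 2) hfin) ?_
    ((ae_restrict_iff' hms).2 (Eventually.of_forall fun z hz => ?_))
  · exact (((Complex.continuous_re.comp_continuousOn
      (h.differentiableOn_potential a).continuousOn).pow 2).mono
        inter_subset_left).aestronglyMeasurable hms
  · rw [Real.norm_of_nonneg (sq_nonneg _), ← sq_abs]
    refine pow_le_pow_left₀ (abs_nonneg _) ((Complex.abs_re_le_norm _).trans ?_) 2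
    have hm := h.exteriorInv_mem hz.1
    have h1 : ‖exteriorInv Φ z‖ ≤ M := hM _ hm (by
      rw [h.apply_exteriorInv hz.1]; exact mem_ball_zero_iff.1 hz.2)
    have h2 : ‖(exteriorInv Φ z)⁻¹‖ ≤ 1 := by
      rw [norm_inv]; exact inv_le_one_of_one_le₀ (le_of_lt hm)
    have hc : ‖(c : ℂ)‖ = c := by rw [Complex.norm_real, Real.norm_of_nonneg h.pos.le]
    have hc0 := h.pos.le
    rw [potential]
    refine (norm_add_le _ _).trans ?_
    rw [norm_mul, norm_mul, norm_mul, RCLike.norm_conj, hc]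
    refine add_le_add (mul_le_mul_of_nonneg_left ((norm_add_le _ _).trans ?_) (norm_nonneg _)) ?_
    · rw [norm_mul, hc]
      gcongr
    · exact mul_le_of_le_one_right (by positivity) h2

theorem integrableOn_gradient_potential_sq (h : IsExteriorConformalMap Ω Φ c μ) (a : ℂ) (R : ℝ) :
    IntegrableOn (fun z => ‖∇ (fun z => (potential Φ c μ a z).re) z‖ ^ 2)
      (exteriorOf Ω ∩ Metric.ball 0 R) := by
  obtain ⟨L, hL⟩ := h.exists_re_lt R
  set s : Set ℂ := halfStrip 0 ∩ (rightHalfPlane ∩ stripMap Φ ⁻¹' Metric.ball 0 R) with hs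
  have himg : exteriorOf Ω ∩ Metric.ball 0 R = stripMap Φ '' s := by
    rw [← h.image_stripMap]
    ext z
    constructor
    · rintro ⟨⟨w, hw, rfl⟩, hz⟩
      exact ⟨w, ⟨hw, halfStrip_subset le_rfl hw, hz⟩, rfl⟩
    · rintro ⟨w, ⟨hw, -, hz⟩, rfl⟩
      exact ⟨⟨w, hw, rfl⟩, hz⟩
  have hms : MeasurableSet s := (measurableSet_halfStrip 0).inter
    (h.contDiffOn_stripMap.continuousOn.isOpen_inter_preimage isOpen_rightHalfPlane
      Metric.isOpen_ball).measurableSet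
  rw [himg, h.integrableOn_image_stripMap hms inter_subset_left]
  have hfin : volume s ≠ ⊤ := by
    refine ((measure_mono ?_).trans_lt (volume_halfStrip_inter_lt_top L)).ne
    exact fun w hw => ⟨hw.1, (hL w hw.2.1 (mem_ball_zero_iff.1 hw.2.2)).le⟩
  have hcongr : EqOn (fun w => ‖a * c * Complex.exp w
      - (starRingEnd ℂ) (a * c) * Complex.exp (-w)‖ ^ 2)
      (fun w => ‖deriv (stripMap Φ) w‖ ^ 2
        * ‖∇ (fun z => (potential Φ c μ a z).re) (stripMap Φ w)‖ ^ 2) s := by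
    intro w hw
    simp only
    rw [h.norm_sq_mul_norm_gradient_sq hw.2.1
      (h.differentiableAt_re_potential a (h.stripMap_mem hw.2.1)),
      h.gradient_potential_stripMap a hw.2.1, RCLike.norm_conj]
  refine IntegrableOn.congr_fun ?_ hcongr hms
  refine Integrable.mono' (integrableOn_const (C := (‖a * c‖ * Real.exp L + ‖a * c‖) ^ 2) hfin)
    (Continuous.aestronglyMeasurable (by fun_prop))
    ((ae_restrict_iff' hms).2 (Eventually.of_forall fun w hw => ?_))
  rw [Real.norm_of_nonneg (sq_nonneg _)]
  refine pow_le_pow_left₀ (norm_nonneg _) ((norm_sub_le _ _).trans ?_) 2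
  have h0 : 0 < w.re := hw.2.1
  have hwL := hL w hw.2.1 (mem_ball_zero_iff.1 hw.2.2)
  rw [norm_mul, norm_mul ((starRingEnd ℂ) _), RCLike.norm_conj, Complex.norm_exp,
    Complex.norm_exp, Complex.neg_re]
  refine add_le_add (by gcongr) (mul_le_of_le_one_right (norm_nonneg _) ?_)
  exact Real.exp_le_one_iff.2 (by linarith)

/-- The Dirichlet pairing of the potential with a test function, transported to the half-strip. -/
theorem neumann_potential (h : IsExteriorConformalMap Ω Φ c μ) (a : ℂ) {v : ℂ → ℝ}
    (hv : IsExteriorTestFunction Ω v) :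
    ∫ z in exteriorOf Ω, inner ℝ (∇ (fun z => (potential Φ c μ a z).re) z) (∇ v z) = 0 := by
  obtain ⟨R, hR⟩ := hv.bounded_support
  obtain ⟨L, hL⟩ := h.exists_re_lt R
  have hvd : ∀ z ∈ exteriorOf Ω, DifferentiableAt ℝ v z := fun z hz =>
    (hv.smooth.differentiableOn (by simp)).differentiableAt ((isOpen_exteriorOf Ω).mem_nhds hz)
  have hms := measurableSet_halfStrip 0
  rw [h.setIntegral_exteriorOf]
  have hW2 : IntegrableOn (fun w => ‖∇ (fun x => v (stripMap Φ x)) w‖ ^ 2) (halfStrip 0) := by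
    have h1 := hv.grad_sq_integrable
    rw [← h.image_stripMap, h.integrableOn_image_stripMap hms subset_rfl] at h1
    refine h1.congr_fun (fun w hw => ?_) hms
    exact h.norm_sq_mul_norm_gradient_sq (halfStrip_subset le_rfl hw)
      (hvd _ (h.stripMap_mem (halfStrip_subset le_rfl hw)))
  have key := setIntegral_halfStrip_re_eq_zero (W := fun x => v (stripMap Φ x)) (L := L)
    ((hv.smooth.comp h.contDiffOn_stripMap fun w hw => h.stripMap_mem hw).of_le (by simp))
    (fun w _ => by
      simp only [stripMap]
      rw [show Complex.exp (w + 2 * Real.pi * Complex.I) = Complex.exp w from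
        Complex.exp_periodic w])
    (fun w hw hwL => hR _ (h.stripMap_mem hw) (by
      by_contra! hlt
      exact absurd (hL w hw hlt) (not_lt.2 hwL)))
    hW2 (a * c)
  refine Eq.trans ?_ key
  refine setIntegral_congr_fun hms fun w hw => ?_
  have hw' := halfStrip_subset le_rfl hw
  rw [h.norm_sq_mul_inner_gradient hw' (h.differentiableAt_re_potential a (h.stripMap_mem hw'))
    (hvd _ (h.stripMap_mem hw')), h.gradient_potential_stripMap a hw', Complex.inner,
    Complex.conj_conj, mul_comm]

end IsExteriorConformalMap

/-! ### The expansion of the solution at infinity -/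

/-- The number `a` for which the background potential `P_1^β` is `Re (a z)`. -/
noncomputable def Trig.slope : Trig → ℂ
  | .c => 1
  | .s => -Complex.I

theorem harmonicPoly_one (β : Trig) (z : ℂ) : harmonicPoly β 1 z = (β.slope * z).re := by
  cases β <;> simp [harmonicPoly, Trig.slope]

/-- The function `w ↦ Φ (1 / w) - c / w - μ₀`, extended by `0` to the origin. -/
noncomputable def laurentTail (Φ : ℂ → ℂ) (c : ℝ) (μ : ℕ → ℂ) (w : ℂ) : ℂ :=
  if w = 0 then 0 else Φ w⁻¹ - c * w⁻¹ - μ 0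

theorem multipoleCoeff_of_re_im {b : ℂ} {m : ℕ} (hm : m ≠ 0) {A : Trig → ℕ → ℝ}
    (hc : A .c m = -(2 * Real.pi * m) * b.re) (hs : A .s m = -(2 * Real.pi * m) * b.im) :
    multipoleCoeff A m = b := by
  have hm' : (m : ℂ) ≠ 0 := by exact_mod_cast hm
  have hπ : (Real.pi : ℂ) ≠ 0 := by exact_mod_cast Real.pi_ne_zero
  rw [multipoleCoeff, hc, hs]
  conv_rhs => rw [← Complex.re_add_im b]
  push_cast
  field_simp
  ring

theorem gamma1_one_eq (Ω : Set ℂ) (m : ℕ) : gamma1 Ω m 1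
    = -(multipoleCoeff (fun α m => gpt Ω α .c m 1) m
        + Complex.I * multipoleCoeff (fun α m => gpt Ω α .s m 1) m) / 2 := by
  simp only [gamma1, multipoleCoeff, div_eq_mul_inv, mul_inv]
  linear_combination (-(gpt Ω .s .s m 1 : ℂ) * (Real.pi : ℂ)⁻¹ * (m : ℂ)⁻¹ / 4) * Complex.I_sq

theorem gamma2_one_eq (Ω : Set ℂ) (m : ℕ) : gamma2 Ω m 1
    = -(multipoleCoeff (fun α m => gpt Ω α .c m 1) m
        - Complex.I * multipoleCoeff (fun α m => gpt Ω α .s m 1) m) / 2 := by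
  simp only [gamma2, multipoleCoeff, div_eq_mul_inv, mul_inv]
  linear_combination ((gpt Ω .s .s m 1 : ℂ) * (Real.pi : ℂ)⁻¹ * (m : ℂ)⁻¹ / 4) * Complex.I_sq

theorem HasTaylorAtZero.eventually_hasSum_inv {f : ℂ → ℂ} {a : ℕ → ℂ} (h : HasTaylorAtZero f a)
    (h0 : f 0 = 0) :
    ∀ᶠ z in cobounded ℂ, HasSum (fun i : ℕ => a (i + 1) * z⁻¹ ^ (i + 1)) (f z⁻¹) := by
  have ha : a 0 = 0 := by rw [← h.apply_zero, h0]
  filter_upwards [(tendsto_inv₀_cobounded (α := ℂ)).eventually h] with z hz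
  rw [← hasSum_nat_add_iff' 1] at hz
  simpa [ha] using hz

namespace IsExteriorConformalMap

variable {Ω : Set ℂ} {Φ : ℂ → ℂ} {c : ℝ} {μ : ℕ → ℂ}

theorem hasTaylorAtZero_laurentTail (h : IsExteriorConformalMap Ω Φ c μ) :
    HasTaylorAtZero (laurentTail Φ c μ) (fun n => if n = 0 then 0 else μ n) := by
  filter_upwards [Metric.ball_mem_nhds (0 : ℂ) one_pos] with w hw
  rw [← hasSum_nat_add_iff' 1]
  by_cases h0 : w = 0
  · subst h0; simp [laurentTail, hasSum_zero]
  · have h1 := (hasSum_nat_add_iff' 1).2 (h.hasSum_of_norm_lt_one h0 (by simpa using hw))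
    simpa [laurentTail, h0] using h1

/-- With `ζ` the preimage of `z` and `w = 1 / ζ`, the perturbation of the potential is
`conj a c w - a ∑_{l ≥ 1} μ_l w ^ l`. -/
theorem potential_sub_eq (h : IsExteriorConformalMap Ω Φ c μ) (hΩ : IsBounded Ω) {κ : ℂ → ℂ}
    (hκ : ∀ᶠ z in cobounded ℂ, exteriorInv Φ z = (κ z⁻¹)⁻¹ ∧ κ z⁻¹ ≠ 0) (a : ℂ) :
    ∀ᶠ z in cobounded ℂ, potential Φ c μ a z - a * z
      = (starRingEnd ℂ) a * c * κ z⁻¹ - a * laurentTail Φ c μ (κ z⁻¹) := by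
  filter_upwards [hκ, eventually_mem_exteriorOf hΩ] with z hz hzD
  have h1 := h.apply_exteriorInv hzD
  rw [hz.1] at h1
  rw [potential, laurentTail, if_neg hz.2, hz.1, h1, inv_inv]
  ring

theorem analyticAt_perturbation (h : IsExteriorConformalMap Ω Φ c μ) {κ : ℂ → ℂ}
    (hκa : AnalyticAt ℂ κ 0) (hκ0 : κ 0 = 0) (a : ℂ) :
    AnalyticAt ℂ (fun x => (starRingEnd ℂ) a * c * κ x - a * laurentTail Φ c μ (κ x)) 0 :=
  (analyticAt_const.mul hκa).sub (analyticAt_const.mul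
    (AnalyticAt.comp_of_eq h.hasTaylorAtZero_laurentTail.analyticAt hκa hκ0))

theorem isNeumannSolution_potential (h : IsExteriorConformalMap Ω Φ c μ) (hΩ : IsBounded Ω)
    (β : Trig) : IsNeumannSolution Ω (harmonicPoly β 1)
      (fun z => (potential Φ c μ β.slope z).re) := by
  refine ⟨?_, h.integrableOn_potential_sq _, h.integrableOn_gradient_potential_sq _,
    fun v hv => h.neumann_potential _ hv, ?_⟩
  · exact fun z hz => ((h.differentiableOn_potential _).analyticAt
      ((isOpen_exteriorOf Ω).mem_nhds hz)).harmonicAt_re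
  · obtain ⟨κ, hκa, hκ0, -, hκ⟩ := h.exists_inverse_germ
    set G : ℂ → ℂ := fun x => (starRingEnd ℂ) β.slope * c * κ x
      - β.slope * laurentTail Φ c μ (κ x) with hG
    have hGd : DifferentiableAt ℂ G 0 := (h.analyticAt_perturbation hκa hκ0 _).differentiableAt
    have hG0 : G 0 = 0 := by simp [hG, hκ0, laurentTail]
    have h1 := hGd.isBigO_sub.comp_tendsto (tendsto_inv₀_cobounded (α := ℂ))
    have h2 : (fun z => (potential Φ c μ β.slope z).re - harmonicPoly β 1 z)
        =O[cobounded ℂ] fun z => G z⁻¹ := by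
      refine IsBigO.of_bound 1 ?_
      filter_upwards [h.potential_sub_eq hΩ hκ β.slope] with z hz
      rw [harmonicPoly_one, ← Complex.sub_re, hz, one_mul]
      exact Complex.abs_re_le_norm _
    refine h2.trans ?_
    simp only [hG0, sub_zero, Function.comp_def] at h1
    refine h1.trans (IsBigO.of_bound 1 (Eventually.of_forall fun z => by simp))

/-- The multipolar expansion exists and its coefficients, hence the polarization tensors, are those
of the holomorphic germ `x ↦ conj a c κ (x) - a ∑_{l ≥ 1} μ_l κ (x) ^ l`. -/
theorem hasTaylorAtZero_multipoleCoeff (h : IsExteriorConformalMap Ω Φ c μ) (hΩ : IsBounded Ω)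
    {κ : ℂ → ℂ} (hκa : AnalyticAt ℂ κ 0) (hκ0 : κ 0 = 0)
    (hκ : ∀ᶠ z in cobounded ℂ, exteriorInv Φ z = (κ z⁻¹)⁻¹ ∧ κ z⁻¹ ≠ 0) (β : Trig) :
    IsMultipolarExpansion Ω β 1 (fun α m => gpt Ω α β m 1) ∧
    (∀ A : Trig → ℕ → ℝ, IsMultipolarExpansion Ω β 1 A →
        ∀ (α : Trig) (m : ℕ), 1 ≤ m → A α m = gpt Ω α β m 1) ∧
    HasTaylorAtZero (fun x => (starRingEnd ℂ) β.slope * c * κ x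
      - β.slope * laurentTail Φ c μ (κ x))
      (fun m => if m = 0 then 0 else multipoleCoeff (fun α m => gpt Ω α β m 1) m) := by
  set G : ℂ → ℂ := fun x => (starRingEnd ℂ) β.slope * c * κ x
    - β.slope * laurentTail Φ c μ (κ x) with hG
  have hGa : AnalyticAt ℂ G 0 := h.analyticAt_perturbation hκa hκ0 _
  have hG0 : G 0 = 0 := by simp [hG, hκ0, laurentTail]
  obtain ⟨b, hb⟩ := hGa.exists_hasTaylorAtZero
  set u : ℂ → ℝ := fun z => (potential Φ c μ β.slope z).re with hu
  have hus : IsNeumannSolution Ω (harmonicPoly β 1) u := h.isNeumannSolution_potential hΩ β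
  set A₀ : Trig → ℕ → ℝ := fun α m => match α with
    | .c => -(2 * Real.pi * m) * (b m).re
    | .s => -(2 * Real.pi * m) * (b m).im with hA₀
  have hA₀b : ∀ m : ℕ, m ≠ 0 → multipoleCoeff A₀ m = b m := fun m hm =>
    multipoleCoeff_of_re_im hm rfl rfl
  have hsum : ∀ᶠ z in cobounded ℂ, HasSum
      (fun i : ℕ => (multipoleCoeff A₀ (i + 1) * z⁻¹ ^ (i + 1)).re) (u z - harmonicPoly β 1 z) := by
    filter_upwards [hb.eventually_hasSum_inv hG0, h.potential_sub_eq hΩ hκ β.slope] with z h1 h2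
    have h3 := Complex.hasSum_re h1
    simp only [hG] at h3
    rw [← h2, Complex.sub_re, ← harmonicPoly_one] at h3
    simpa only [hA₀b _ (Nat.succ_ne_zero _)] using h3
  have hex : IsMultipolarExpansion Ω β 1 A₀ := by
    refine ⟨u, hus, ?_⟩
    simpa only [re_multipoleCoeff_mul] using hsum
  have huniq : ∀ A : Trig → ℕ → ℝ, IsMultipolarExpansion Ω β 1 A →
      ∀ (α : Trig) (m : ℕ), 1 ≤ m → A α m = A₀ α m := by
    rintro A ⟨u', hu', hA⟩ α m hm
    simp only [re_multipoleCoeff_mul] at hA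
    refine multipolar_unique ?_ hsum α hm
    filter_upwards [hA, eventually_mem_exteriorOf hΩ] with z h1 h2
    rwa [hu'.eqOn hΩ h.isPreconnected_exteriorOf hus h2] at h1
  have hgpt : IsMultipolarExpansion Ω β 1 (fun α m => gpt Ω α β m 1) :=
    Classical.epsilon_spec ⟨A₀, hex⟩
  refine ⟨hgpt, fun A hA α m hm => (huniq A hA α m hm).trans (huniq _ hgpt α m hm).symm, ?_⟩
  convert! hb using 1
  ext m
  split_ifs with hm
  · rw [hm, ← hb.apply_zero, hG0]
  · rw [← hA₀b m hm]
    have hm1 : 1 ≤ m := Nat.one_le_iff_ne_zero.2 hm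
    simp only [multipoleCoeff, huniq _ hgpt _ m hm1]

/-- The two families of tensors separate the perturbation: the `γ¹` are the coefficients of the
tail `∑_{l ≥ 1} μ_l ζ ^ (-l)` and the `γ²` those of `-c / ζ`, as power series in `1 / z`. -/
theorem exists_hasTaylorAtZero_gamma (h : IsExteriorConformalMap Ω Φ c μ) (hΩ : IsBounded Ω) :
    ∃ κ : ℂ → ℂ, (∀ᶠ w in 𝓝[≠] 0, κ (invAtInfinity Φ w) = w) ∧ κ 0 = 0 ∧
      HasTaylorAtZero (fun x => laurentTail Φ c μ (κ x))
        (fun m => if m = 0 then 0 else gamma1 Ω m 1) ∧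
      HasTaylorAtZero (fun x => -c * κ x) (fun m => if m = 0 then 0 else gamma2 Ω m 1) := by
  obtain ⟨κ, hκa, hκ0, hκk, hκ⟩ := h.exists_inverse_germ
  have hc := (h.hasTaylorAtZero_multipoleCoeff hΩ hκa hκ0 hκ .c).2.2
  have hs := (h.hasTaylorAtZero_multipoleCoeff hΩ hκa hκ0 hκ .s).2.2
  refine ⟨κ, hκk, hκ0, ?_, ?_⟩
  · filter_upwards [hc, hs] with x h1 h2
    convert! (h1.add (h2.mul_left Complex.I)).mul_left (-1 / 2) using 1
    · ext m
      split_ifs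
      · simp
      · rw [gamma1_one_eq]; ring
    · simp only [Trig.slope, map_one, map_neg, Complex.conj_I]
      linear_combination (c * κ x / 2 + laurentTail Φ c μ (κ x) / 2) * Complex.I_sq
  · filter_upwards [hc, hs] with x h1 h2
    convert! (h1.sub (h2.mul_left Complex.I)).mul_left (-1 / 2) using 1
    · ext m
      split_ifs
      · simp
      · rw [gamma2_one_eq]; ring
    · simp only [Trig.slope, map_one, map_neg, Complex.conj_I]
      linear_combination (-c * κ x / 2 - laurentTail Φ c μ (κ x) / 2) * Complex.I_sq

theorem eventually_inverse_germ {κ : ℂ → ℂ} (hκ0 : κ 0 = 0)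
    (hκ : ∀ᶠ w in 𝓝[≠] 0, κ (invAtInfinity Φ w) = w) :
    ∀ᶠ w in 𝓝 (0 : ℂ), κ (if w = 0 then 0 else invAtInfinity Φ w) = w := by
  rw [eventually_nhdsWithin_iff] at hκ
  filter_upwards [hκ] with w hw
  split_ifs with h0
  · rw [hκ0, h0]
  · exact hw h0

theorem _root_.Nat.Partition.card_parts_ne_zero {l : ℕ} (hl : 1 ≤ l) (p : Nat.Partition l) :
    Multiset.card p.parts ≠ 0 := by
  intro h0
  have := p.parts_sum
  rw [Multiset.card_eq_zero.1 h0, Multiset.sum_zero] at this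
  omega

/-- Obtained by substituting `x = 1 / Φ (ζ) = ∑ B_k ζ ^ (-k)` into the series of the `γ¹`
and comparing coefficients of `ζ ^ (-l)`. -/
theorem coeff_eq_sum_gamma1 (h : IsExteriorConformalMap Ω Φ c μ) (hΩ : IsBounded Ω) {l : ℕ}
    (hl : 1 ≤ l) : μ l = ∑ p : Nat.Partition l,
      gamma1 Ω (Multiset.card p.parts) 1 * multinomialCoeff p
        * ∏ n ∈ p.parts.toFinset, coeffB c μ n ^ p.parts.count n := by
  obtain ⟨κ, hκ, hκ0, h1, -⟩ := h.exists_hasTaylorAtZero_gamma hΩ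
  have h2 := h1.comp h.hasTaylorAtZero_invAtInfinity (by simp)
  have h3 : HasTaylorAtZero _ _ := h2.congr (g := laurentTail Φ c μ) (by
    filter_upwards [eventually_inverse_germ hκ0 hκ] with w hw
    simp only [Function.comp, hw])
  have h4 := congrFun (h.hasTaylorAtZero_laurentTail.unique h3) l
  simp only [if_neg (show l ≠ 0 by omega)] at h4
  rw [h4]
  refine Finset.sum_congr rfl fun p _ => ?_
  rw [if_neg (Nat.Partition.card_parts_ne_zero hl p)]

/-- Obtained by the same substitution into the series of the `γ²`, which sums to `-c / ζ`. -/
theorem sum_gamma2_eq (h : IsExteriorConformalMap Ω Φ c μ) (hΩ : IsBounded Ω) {l : ℕ}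
    (hl : 1 ≤ l) : ∑ p : Nat.Partition l,
      gamma2 Ω (Multiset.card p.parts) 1 * multinomialCoeff p
        * ∏ n ∈ p.parts.toFinset, coeffB c μ n ^ p.parts.count n
      = if l = 1 then -(c : ℂ) else 0 := by
  obtain ⟨κ, hκ, hκ0, -, h1⟩ := h.exists_hasTaylorAtZero_gamma hΩ
  have h2 := h1.comp h.hasTaylorAtZero_invAtInfinity (by simp)
  have h3 : HasTaylorAtZero _ _ := h2.congr (g := fun w => -c * w) (by
    filter_upwards [eventually_inverse_germ hκ0 hκ] with w hw
    simp only [Function.comp, hw])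
  have h5 : HasTaylorAtZero (fun w => -c * w) (fun n => if n = 1 then -(c : ℂ) else 0) := by
    refine Eventually.of_forall fun w => ?_
    convert! hasSum_single (f := fun n : ℕ => (if n = 1 then -(c : ℂ) else 0) * w ^ n) 1
      (fun n hn => by simp [hn]) using 1
    simp
  have h4 := congrFun (h5.unique h3) l
  rw [h4]
  refine Finset.sum_congr rfl fun p _ => ?_
  rw [if_neg (Nat.Partition.card_parts_ne_zero hl p)]

end IsExteriorConformalMap

/-! ### The conformal map in terms of the tensors -/

theorem univ_composition_one :
    (Finset.univ : Finset (Composition 1)) = {Composition.single 1 one_pos} :=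
  (Finset.eq_univ_of_card _ (by rw [composition_card]; rfl)).symm

theorem single_two_ne_ones : Composition.single 2 two_pos ≠ Composition.ones 2 := by
  decide

theorem univ_composition_two : (Finset.univ : Finset (Composition 2))
    = {Composition.single 2 two_pos, Composition.ones 2} :=
  (Finset.eq_univ_of_card _ (by
    rw [composition_card, Finset.card_pair single_two_ne_ones]; rfl)).symm

namespace IsExteriorConformalMap

variable {Ω : Set ℂ} {Φ : ℂ → ℂ} {c : ℝ} {μ : ℕ → ℂ}

theorem coeffB_one (c : ℝ) (μ : ℕ → ℂ) : coeffB c μ 1 = 1 / c := by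
  simp [coeffB, multinomialCoeff]

theorem coeffB_two (c : ℝ) (μ : ℕ → ℂ) : coeffB c μ 2 = -μ 0 / c ^ 2 := by
  have h := sum_composition_eq_sum_partition 1 (fun n => (-1 / (c : ℂ)) ^ n) (fun n => μ (n - 1))
  rw [coeffB, ← h, univ_composition_one]
  simp
  ring

theorem sq_eq_neg_gamma2 (h : IsExteriorConformalMap Ω Φ c μ) (hΩ : IsBounded Ω) :
    (c : ℂ) ^ 2 = -gamma2 Ω 1 1 := by
  have hc := h.c_ne_zero
  have h1 := h.sum_gamma2_eq hΩ le_rfl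
  rw [← sum_composition_eq_sum_partition 1 (fun n => gamma2 Ω n 1) (coeffB c μ),
    univ_composition_one] at h1
  simp [coeffB_one] at h1
  field_simp at h1
  rw [h1]
  ring

theorem coeff_zero_eq (h : IsExteriorConformalMap Ω Φ c μ) (hΩ : IsBounded Ω) :
    μ 0 = -gamma2 Ω 2 1 / (c : ℂ) ^ 2 := by
  have hc := h.c_ne_zero
  have h1 := h.sum_gamma2_eq hΩ one_le_two
  have h2 := h.sq_eq_neg_gamma2 hΩ
  rw [← sum_composition_eq_sum_partition 2 (fun n => gamma2 Ω n 1) (coeffB c μ),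
    univ_composition_two, Finset.sum_pair single_two_ne_ones] at h1
  simp [coeffB_one, coeffB_two, Composition.ones] at h1
  field_simp at h1 ⊢
  linear_combination h1 + μ 0 * h2

theorem coeffB_congr {c : ℝ} {μ ν : ℕ → ℂ} {k : ℕ} (hν : ∀ j : ℕ, j + 2 ≤ k → ν j = μ j) :
    coeffB c ν k = coeffB c μ k := by
  cases k with
  | zero => rfl
  | succ k =>
    simp only [coeffB]
    congr 1
    refine Finset.sum_congr rfl fun p _ => ?_
    congr 1
    refine Finset.prod_congr rfl fun n hn => ?_
    have h1 := p.parts_pos (Multiset.mem_toFinset.1 hn)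
    have h2 := p.le_of_mem_parts (Multiset.mem_toFinset.1 hn)
    rw [hν (n - 1) (by omega)]

/-- By strong induction on `l`: the formula for `μ_l` involves only `γ¹_{m1}` with `m ≤ l` and `B_n`
with `n ≤ l`, and the latter depend only on `c` and the `μ_j` with `j ≤ l - 2`. -/
theorem coeff_determined {Ω' : Set ℂ} {Φ' : ℂ → ℂ} {c' : ℝ} {μ' : ℕ → ℂ}
    (h : IsExteriorConformalMap Ω Φ c μ) (hΩ : IsBounded Ω)
    (h' : IsExteriorConformalMap Ω' Φ' c' μ') (hΩ' : IsBounded Ω')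
    (h11 : gamma2 Ω' 1 1 = gamma2 Ω 1 1) (h21 : gamma2 Ω' 2 1 = gamma2 Ω 2 1) (N : ℕ)
    (hN : ∀ m : ℕ, 1 ≤ m → m ≤ N → gamma1 Ω' m 1 = gamma1 Ω m 1) :
    c' = c ∧ ∀ l : ℕ, l ≤ N → μ' l = μ l := by
  have hcc : c' = c := by
    have h1 : (c' : ℂ) ^ 2 = (c : ℂ) ^ 2 := by
      rw [h'.sq_eq_neg_gamma2 hΩ', h.sq_eq_neg_gamma2 hΩ, h11]
    exact (sq_eq_sq₀ h'.pos.le h.pos.le).1 (by exact_mod_cast h1)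
  refine ⟨hcc, fun l => ?_⟩
  induction l using Nat.strong_induction_on with
  | _ l ih =>
    intro hl
    rcases Nat.eq_zero_or_pos l with rfl | hpos
    · rw [h'.coeff_zero_eq hΩ', h.coeff_zero_eq hΩ, h21, hcc]
    · rw [h'.coeff_eq_sum_gamma1 hΩ' hpos, h.coeff_eq_sum_gamma1 hΩ hpos]
      refine Finset.sum_congr rfl fun p _ => ?_
      have hcard : Multiset.card p.parts ≤ l := by
        have := Multiset.card_nsmul_le_sum (s := p.parts) (a := 1) fun x hx => p.parts_pos hx
        simpa [p.parts_sum] using this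
      rw [hN _ (Nat.one_le_iff_ne_zero.2 (Nat.Partition.card_parts_ne_zero hpos p))
        (hcard.trans hl)]
      congr 1
      refine Finset.prod_congr rfl fun n hn => ?_
      have hn' := p.le_of_mem_parts (Multiset.mem_toFinset.1 hn)
      rw [hcc, coeffB_congr fun j hj => ih j (by omega) (by omega)]

end IsExteriorConformalMap

theorem mainTheorem2
    (Ω : Set ℂ) (hΩ : IsBoundedLipschitzDomain Ω) (hsc : IsSimplyConnected Ω)
    (Φ : ℂ → ℂ) (c : ℝ) (μ : ℕ → ℂ) (hΦ : IsExteriorConformalMap Ω Φ c μ) :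
    -- the tensors of first order in `n` are well defined
    (∀ β : Trig, IsMultipolarExpansion Ω β 1 (fun α m => gpt Ω α β m 1) ∧
      ∀ A : Trig → ℕ → ℝ, IsMultipolarExpansion Ω β 1 A →
        ∀ (α : Trig) (m : ℕ), 1 ≤ m → A α m = gpt Ω α β m 1) ∧
    -- the `B_k` are the coefficients of the expansion of `1 / Φ`
    (∀ᶠ ζ in cobounded ℂ,
      HasSum (fun i : ℕ => coeffB c μ (i + 1) / ζ ^ (i + 1)) (1 / Φ ζ)) ∧
    -- `B_k` depends only on `c` and on `μ_j` for `j ≤ k - 2`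
    (∀ (k : ℕ) (ν : ℕ → ℂ), (∀ j : ℕ, j + 2 ≤ k → ν j = μ j) →
      coeffB c ν k = coeffB c μ k) ∧
    -- the first two coefficients
    (c : ℂ) ^ 2 = -gamma2 Ω 1 1 ∧
    μ 0 = -gamma2 Ω 2 1 / (c : ℂ) ^ 2 ∧
    -- the coefficients of higher order
    (∀ l : ℕ, 1 ≤ l → μ l = ∑ p : Nat.Partition l,
      gamma1 Ω (Multiset.card p.parts) 1 * multinomialCoeff p
        * ∏ n ∈ p.parts.toFinset, coeffB c μ n ^ p.parts.count n) ∧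
    -- the coefficients, and the map, are determined by the tensors
    (∀ (Ω' : Set ℂ) (Φ' : ℂ → ℂ) (c' : ℝ) (μ' : ℕ → ℂ),
      IsBoundedLipschitzDomain Ω' → IsSimplyConnected Ω' →
      IsExteriorConformalMap Ω' Φ' c' μ' →
      gamma2 Ω' 1 1 = gamma2 Ω 1 1 → gamma2 Ω' 2 1 = gamma2 Ω 2 1 →
      (∀ N : ℕ, (∀ m : ℕ, 1 ≤ m → m ≤ N → gamma1 Ω' m 1 = gamma1 Ω m 1) →
        c' = c ∧ ∀ l : ℕ, l ≤ N → μ' l = μ l) ∧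
      ((∀ m : ℕ, 1 ≤ m → gamma1 Ω' m 1 = gamma1 Ω m 1) →
        EqOn Φ' Φ {ζ | 1 < ‖ζ‖})) := by
  have hb := hΩ.isBounded
  obtain ⟨κ, hκa, hκ0, -, hκ⟩ := hΦ.exists_inverse_germ
  refine ⟨fun β => ?_, ?_, fun k ν hν => IsExteriorConformalMap.coeffB_congr hν,
    hΦ.sq_eq_neg_gamma2 hb, hΦ.coeff_zero_eq hb, fun l hl => hΦ.coeff_eq_sum_gamma1 hb hl, ?_⟩
  · have h := hΦ.hasTaylorAtZero_multipoleCoeff hb hκa hκ0 hκ β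
    exact ⟨h.1, h.2.1⟩
  · filter_upwards [hΦ.hasTaylorAtZero_invAtInfinity.eventually_hasSum_inv (by simp),
      eventually_ne_cobounded (0 : ℂ)] with ζ h h0
    simpa [invAtInfinity, h0, div_eq_mul_inv] using h
  · intro Ω' Φ' c' μ' hΩ' _ hΦ' h11 h21
    have hdet := hΦ.coeff_determined hb hΦ' hΩ'.isBounded h11 h21
    refine ⟨hdet, fun hall ζ hζ => ?_⟩
    have hc := (hdet 0 fun m _ _ => hall m ‹_›).1
    have hμ : μ' = μ := funext fun l => (hdet l fun m hm _ => hall m hm).2 l le_rfl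
    have h1 := hΦ'.expansion ζ hζ
    rw [hμ, hc] at h1
    exact sub_left_injective (h1.unique (hΦ.expansion ζ hζ))
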